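/- Let $(\bar M,\bar g)$ be a smooth $4$-dimensional Lorentzian manifold with Levi-Civita connection $\bar\nabla$, and let $(M,g,S(TM))$ be a null hypersurface of $\bar M$: a $3$-manifold $M$ immersed in $\bar M$ whose induced metric $g$ is degenerate, together with a screen distribution, i.e. a smooth subbundle $S(TM)\subset TM$ with $TM=S(TM)\oplus \mathrm{rad}(TM)$, where $\mathrm{rad}(TM)=TM\cap TM^{\perp}$ (so $S(TM)$ has rank $2$ and $g|_{S(TM)}$ is positive definite). Write $Y^*$ and $Y^\perp=Y-Y^*$ for the components of a vector field $Y$ of $\bar M$ along $M$ with respect to $T\bar M=S(TM)\oplus S(TM)^{\perp}$. The screen connection is $\overset{*}{\nabla}_XV=(\bar\nabla_XV)^*$ for $X\in\Gamma(TM)$, $V\in\Gamma(S(TM))$, and the shape operator of $Y^\perp$ is $A_{Y^\perp}X=-(\bar\nabla_XY^\perp)^*$ for $X\in\Gamma(S(TM))$. Suppose that $S(TM)$ is integrable (closed under Lie brackets), and let $Z$ be a smooth vector field of $\bar M$ along $M$ which is parallel ($\bar\nabla_XZ=0$ for all $X\in TM$) and such that * $M$ has constant angle with respect to $Z$: $\bar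 g(Z,Z)$ vanishes nowhere and there are smooth sections $\xi$ of $\mathrm{rad}(TM)$ and $N$ of $T\bar M|_M$ with $\bar g(\xi,N)=1$, $\bar g(N,N)=0$, $N\perp S(TM)$, for which the functions $\bar g(Z,\xi)/|Z|$ and $\bar g(Z,N)/|Z|$ are constant on $M$, where $|Z|=\sqrt{|\bar g(Z,Z)|}$; * the screen component $Z^*$ vanishes nowhere, so that $T=Z^*/|Z^*|$ is defined; * $\mathrm{tr}\,A_{Z^\perp}\equiv 0$ on $S(TM)$. Then $S(TM)$ is flat: $\overset{*}{R}(X,Y)V=\overset{*}{\nabla}_X\overset{*}{\nabla}_YV-\overset{*}{\nabla}_Y\overset{*}{\nabla}_XV-\overset{*}{\nabla}_{[X,Y]}V=0$ for all local smooth sections $X,Y,V$ of $S(TM)$ (equivalently, the leaves of $S(TM)$ are flat Riemannian surfaces). More precisely, around every point $T$ can be completed to a smooth orthonormal frame $\{T,W\}$ of $S(TM)$, and every such local frame is parallel along the screen: $$\overset{*}{\nabla}_TT=\overset{*}{\nabla}_WT=\overset{*}{\nabla}_TW=\overset{*}{\nabla}_WW=0 .$$ -/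

import Mathlib

open Bundle Set
open scoped Manifold ContDiff Topology

noncomputable section

/-! ## Lorentzian manifolds and the Levi-Civita connection along a map -/

section Lorentz

variable {E : Type*} [NormedAddCommGroup E] [NormedSpace ℝ E]
  {N : Type*} [TopologicalSpace N] [ChartedSpace E N]

instance instFiniteDimensionalTangentSpaceSelf [FiniteDimensional ℝ E] (x : N) :
    FiniteDimensional ℝ (TangentSpace 𝓘(ℝ, E) x) :=
  inferInstanceAs (FiniteDimensional ℝ E)

variable [IsManifold 𝓘(ℝ, E) ∞ N]

variable (E N) in
/-- A smooth Lorentzian metric on the manifold `N` (signature `(-, +, …, +)`): at each point there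
is a timelike vector on whose orthogonal complement the metric is positive definite. -/
structure LorentzMetric where
  /-- The scalar product on each tangent space. -/
  val (x : N) : TangentSpace 𝓘(ℝ, E) x →L[ℝ] TangentSpace 𝓘(ℝ, E) x →L[ℝ] ℝ
  symm (x : N) (v w : TangentSpace 𝓘(ℝ, E) x) : val x v w = val x w v
  lorentzian (x : N) : ∃ t : TangentSpace 𝓘(ℝ, E) x, val x t t < 0 ∧
    ∀ w : TangentSpace 𝓘(ℝ, E) x, val x t w = 0 → w ≠ 0 → 0 < val x w w
  contMDiff : ContMDiff 𝓘(ℝ, E) (𝓘(ℝ, E).prod 𝓘(ℝ, E →L[ℝ] E →L[ℝ] ℝ)) ∞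
    (fun x ↦ TotalSpace.mk' (E →L[ℝ] E →L[ℝ] ℝ) x (val x))

namespace LorentzMetric

variable (g : LorentzMetric E N)

/-- The metric at `x` as a bilinear form. -/
def form (x : N) : LinearMap.BilinForm ℝ (TangentSpace 𝓘(ℝ, E) x) :=
  LinearMap.mk₂ ℝ (fun v w ↦ g.val x v w) (by simp) (by simp) (by simp) (by simp)

@[simp] lemma form_apply (x : N) (v w : TangentSpace 𝓘(ℝ, E) x) :
    g.form x v w = g.val x v w := rfl

lemma eq_zero_of_forall (x : N) (v : TangentSpace 𝓘(ℝ, E) x)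
    (h : ∀ w, g.val x v w = 0) : v = 0 := by
  obtain ⟨t, -, ht⟩ := g.lorentzian x
  by_contra hv
  have h1 := ht v (by rw [g.symm]; exact h t) hv
  rw [h v] at h1
  exact lt_irrefl _ h1

lemma form_nondegenerate (x : N) : (g.form x).Nondegenerate := by
  refine ⟨fun v hv ↦ g.eq_zero_of_forall x v hv, fun v hv ↦ g.eq_zero_of_forall x v fun w ↦ ?_⟩
  rw [g.symm]
  exact hv w

/-- The metric coefficients in the preferred chart around `x₀`, as a function of the point:
`coeff x₀ x u v = g_x(U, V)`, where `U`, `V` are the coordinate vector fields near `x₀` with the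
constant components `u`, `v`. -/
def coeff (x₀ x : N) : E →L[ℝ] E →L[ℝ] ℝ :=
  ((trivializationAt E (TangentSpace 𝓘(ℝ, E)) x₀).symmL ℝ x).precomp ℝ ∘L g.val x ∘L
    (trivializationAt E (TangentSpace 𝓘(ℝ, E)) x₀).symmL ℝ x

lemma coeff_apply (x₀ x : N) (u v : E) :
    g.coeff x₀ x u v = g.val x ((trivializationAt E (TangentSpace 𝓘(ℝ, E)) x₀).symmL ℝ x u)
      ((trivializationAt E (TangentSpace 𝓘(ℝ, E)) x₀).symmL ℝ x v) := rfl

/-- The derivative `dcoeff x₀ u v w = ∂_u g(v, w)` at `x₀` of the metric coefficients in the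
preferred chart around `x₀`; the differential of this chart identifies `T_{x₀} N` with `E`
(by the identity map). -/
def dcoeff (x₀ : N) : E →L[ℝ] E →L[ℝ] E →L[ℝ] ℝ :=
  mvfderiv 𝓘(ℝ, E) (g.coeff x₀) x₀

/-- The Christoffel symbols of the first kind at `x₀`, in the preferred chart around `x₀`:
`Γ(u, v; w) = ½ (∂_u g(v, w) + ∂_v g(u, w) - ∂_w g(u, v))` is `christoffelLower x₀ v u w`. -/
def christoffelLower (x₀ : N) (v : E) : E →ₗ[ℝ] Module.Dual ℝ E :=
  LinearMap.mk₂ ℝ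
    (fun u w : E ↦ (1 / 2 : ℝ) * (g.dcoeff x₀ u v w + g.dcoeff x₀ v u w - g.dcoeff x₀ w u v))
    (fun u u' w ↦ by simp only [ContinuousLinearMap.map_add, add_apply]; ring)
    (fun c u w ↦ by simp only [ContinuousLinearMap.map_smul, smul_apply, smul_eq_mul]; ring)
    (fun u w w' ↦ by simp only [ContinuousLinearMap.map_add, add_apply]; ring)
    (fun c u w ↦ by simp only [ContinuousLinearMap.map_smul, smul_apply, smul_eq_mul]; ring)

variable [FiniteDimensional ℝ E]

/-- The Christoffel symbols of the second kind at `x₀`, in the preferred chart around `x₀`: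
`christoffel x₀ v u` is the vector `Γ(u, v)` such that `g(Γ(u, v), w) = Γ(u, v; w)` for all `w`. -/
def christoffel (x₀ : N) (v : TangentSpace 𝓘(ℝ, E) x₀) :
    TangentSpace 𝓘(ℝ, E) x₀ →ₗ[ℝ] TangentSpace 𝓘(ℝ, E) x₀ :=
  ((g.form x₀).toDual (g.form_nondegenerate x₀)).symm.toLinearMap ∘ₗ g.christoffelLower x₀ v

variable {F : Type*} [NormedAddCommGroup F] [NormedSpace ℝ F]
  {M : Type*} [TopologicalSpace M] [ChartedSpace F M]

/-- The Levi-Civita connection of `g` acting on vector fields along a map `f : M → N`: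
`g.covAlong f V p X = ∇̄_X V ∈ T_{f p} N`, for `X ∈ T_p M`. In the preferred chart around `f p`
it is `X(V) + Γ(df X, V)`, where `X(V)` differentiates the components of `V` in this chart. -/
def covAlong (f : M → N) (V : ∀ q : M, TangentSpace 𝓘(ℝ, E) (f q)) (p : M) :
    TangentSpace 𝓘(ℝ, F) p →ₗ[ℝ] TangentSpace 𝓘(ℝ, E) (f p) where
  toFun X :=
    (show TangentSpace 𝓘(ℝ, E) (f p) from
      mvfderiv 𝓘(ℝ, F) (fun q ↦ (trivializationAt E (TangentSpace 𝓘(ℝ, E)) (f p)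
        (⟨f q, V q⟩ : TangentBundle 𝓘(ℝ, E) N)).2) p X) +
      g.christoffel (f p) (V p) (mfderiv 𝓘(ℝ, F) 𝓘(ℝ, E) f p X)
  map_add' X Y := by
    rw [map_add, map_add, map_add]
    exact add_add_add_comm _ _ _ _
  map_smul' c X := by
    rw [map_smul, map_smul, map_smul]
    exact (smul_add c _ _).symm

end LorentzMetric

end Lorentz

/-! ## Distributions -/

section Distribution

variable {F : Type*} [NormedAddCommGroup F] [NormedSpace ℝ F]
  {M : Type*} [TopologicalSpace M] [ChartedSpace F M] [IsManifold 𝓘(ℝ, F) ∞ M]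

/-- `X` is, on the set `U`, a smooth section of the distribution `S`. -/
def IsSmoothSectionOn (S : ∀ p : M, Submodule ℝ (TangentSpace 𝓘(ℝ, F) p)) (U : Set M)
    (X : ∀ p : M, TangentSpace 𝓘(ℝ, F) p) : Prop :=
  ContMDiffOn 𝓘(ℝ, F) 𝓘(ℝ, F).tangent ∞ (fun p ↦ (⟨p, X p⟩ : TangentBundle 𝓘(ℝ, F) M)) U ∧
    ∀ p ∈ U, X p ∈ S p

/-- `S` is a smooth vector subbundle of the tangent bundle: it has smooth frames locally. -/
def IsSmoothSubbundle (S : ∀ p : M, Submodule ℝ (TangentSpace 𝓘(ℝ, F) p)) : Prop :=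
  ∀ p : M, ∃ U : Set M, IsOpen U ∧ p ∈ U ∧
    ∃ (k : ℕ) (e : Fin k → ∀ q : M, TangentSpace 𝓘(ℝ, F) q),
      (∀ i, IsSmoothSectionOn S U (e i)) ∧
      ∀ q ∈ U, LinearIndependent ℝ (fun i ↦ e i q) ∧
        Submodule.span ℝ (Set.range fun i ↦ e i q) = S q

/-- Integrability of a distribution, in Frobenius' form: the bracket of two (local) smooth sections
of the distribution is again a section of it. -/
def IsIntegrableDistribution (S : ∀ p : M, Submodule ℝ (TangentSpace 𝓘(ℝ, F) p)) : Prop :=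
  ∀ (U : Set M), IsOpen U → ∀ X Y : ∀ p : M, TangentSpace 𝓘(ℝ, F) p,
    IsSmoothSectionOn S U X → IsSmoothSectionOn S U Y →
      ∀ p ∈ U, VectorField.mlieBracket 𝓘(ℝ, F) X Y p ∈ S p

end Distribution

/-! ## Null hypersurfaces -/

section Null

variable {E : Type*} [NormedAddCommGroup E] [NormedSpace ℝ E]
  {N : Type*} [TopologicalSpace N] [ChartedSpace E N] [IsManifold 𝓘(ℝ, E) ∞ N]
  {F : Type*} [NormedAddCommGroup F] [NormedSpace ℝ F]
  {M : Type*} [TopologicalSpace M] [ChartedSpace F M]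

/-- The metric induced on `T_p M` by a map `f : M → N`. -/
def inducedForm (g : LorentzMetric E N) (f : M → N) (p : M) :
    LinearMap.BilinForm ℝ (TangentSpace 𝓘(ℝ, F) p) :=
  LinearMap.mk₂ ℝ
    (fun X Y ↦ g.val (f p) (mfderiv 𝓘(ℝ, F) 𝓘(ℝ, E) f p X) (mfderiv 𝓘(ℝ, F) 𝓘(ℝ, E) f p Y))
    (by simp) (by simp) (by simp) (by simp)

/-- The radical space `rad(T_p M)` of the induced metric. -/
def radSpace (g : LorentzMetric E N) (f : M → N) (p : M) :
    Submodule ℝ (TangentSpace 𝓘(ℝ, F) p) :=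
  LinearMap.ker (inducedForm g f p)

variable [IsManifold 𝓘(ℝ, F) ∞ M]

variable (F M) in
/-- A null hypersurface `(M, g, S(TM))` of the Lorentzian manifold `(N, g)`: an immersed
hypersurface with degenerate induced metric, together with a screen distribution `S(TM)`, i.e. a
smooth vector subbundle of `TM` complementary to the radical bundle. -/
structure NullHypersurface (g : LorentzMetric E N) where
  /-- The immersion of `M` into the ambient manifold. -/
  imm : M → N
  contMDiff_imm : ContMDiff 𝓘(ℝ, F) 𝓘(ℝ, E) ∞ imm
  injective_mfderiv (p : M) : Function.Injective (mfderiv 𝓘(ℝ, F) 𝓘(ℝ, E) imm p)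
  codim_one : Module.finrank ℝ E = Module.finrank ℝ F + 1
  degenerate (p : M) : radSpace (F := F) g imm p ≠ ⊥
  /-- The screen distribution. -/
  screen (p : M) : Submodule ℝ (TangentSpace 𝓘(ℝ, F) p)
  screen_smooth : IsSmoothSubbundle screen
  screen_compl (p : M) : IsCompl (screen p) (radSpace g imm p)

namespace NullHypersurface

variable {g : LorentzMetric E N} (H : NullHypersurface F M g)

/-- The differential of the immersion. -/
def push (p : M) : TangentSpace 𝓘(ℝ, F) p →L[ℝ] TangentSpace 𝓘(ℝ, E) (H.imm p) :=
  mfderiv 𝓘(ℝ, F) 𝓘(ℝ, E) H.imm p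

/-- The (degenerate) induced metric on `M`. -/
def metric (p : M) (X Y : TangentSpace 𝓘(ℝ, F) p) : ℝ :=
  g.val (H.imm p) (H.push p X) (H.push p Y)

/-- `Z` is a smooth vector field of the ambient manifold along `M`. -/
def IsSmoothAlong (Z : ∀ p : M, TangentSpace 𝓘(ℝ, E) (H.imm p)) : Prop :=
  ContMDiff 𝓘(ℝ, F) 𝓘(ℝ, E).tangent ∞
    (fun p ↦ (⟨H.imm p, Z p⟩ : TangentBundle 𝓘(ℝ, E) N))

/-- A null frame: nowhere vanishing smooth global sections `ξ` of `rad(TM)` and `ν` of the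
transversal bundle `tr(TM)`, normalized by `ḡ(ξ, ν) = 1`, `ḡ(ν, ν) = 0`, `ν ⊥ S(TM)`. -/
structure IsNullFrame (ξ : ∀ p : M, TangentSpace 𝓘(ℝ, F) p)
    (ν : ∀ p : M, TangentSpace 𝓘(ℝ, E) (H.imm p)) : Prop where
  smooth_left : IsSmoothSectionOn (fun p ↦ radSpace g H.imm p) univ ξ
  smooth_right : H.IsSmoothAlong ν
  inner_eq_one (p : M) : g.val (H.imm p) (H.push p (ξ p)) (ν p) = 1
  inner_self (p : M) : g.val (H.imm p) (ν p) (ν p) = 0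
  orthogonal (p : M) : ∀ X ∈ H.screen p, g.val (H.imm p) (ν p) (H.push p X) = 0

/-- The length `|V| = √|ḡ(V, V)|` of a vector field along `M`. -/
def length (V : ∀ p : M, TangentSpace 𝓘(ℝ, E) (H.imm p)) (p : M) : ℝ :=
  √|g.val (H.imm p) (V p) (V p)|

/-- The null hypersurface has constant angle with respect to the nowhere null vector field `V`
along `M`: for some null frame `ξ`, `ν`, the functions `ḡ(V, ξ)/|V|` and `ḡ(V, ν)/|V|` are
constant. -/
def HasConstantAngle (V : ∀ p : M, TangentSpace 𝓘(ℝ, E) (H.imm p)) : Prop :=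
  (∀ p, g.val (H.imm p) (V p) (V p) ≠ 0) ∧
    ∃ (ξ : ∀ p : M, TangentSpace 𝓘(ℝ, F) p) (ν : ∀ p : M, TangentSpace 𝓘(ℝ, E) (H.imm p)),
      H.IsNullFrame ξ ν ∧
        (∃ a : ℝ, ∀ p, g.val (H.imm p) (V p) (H.push p (ξ p)) / H.length V p = a) ∧
        ∃ b : ℝ, ∀ p, g.val (H.imm p) (V p) (ν p) / H.length V p = b

/-- The restriction of the induced metric to the screen. -/
def screenForm (p : M) : LinearMap.BilinForm ℝ (H.screen p) :=
  (inducedForm g H.imm p).domRestrict₁₂ (H.screen p) (H.screen p)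

lemma screenForm_apply (p : M) (X Y : H.screen p) :
    H.screenForm p X Y = g.val (H.imm p) (H.push p X) (H.push p Y) := rfl

lemma screenForm_separating (p : M) (X : H.screen p) (h : ∀ Y, H.screenForm p X Y = 0) :
    X = 0 := by
  have hX : (X : TangentSpace 𝓘(ℝ, F) p) ∈ radSpace g H.imm p := by
    refine LinearMap.mem_ker.2 (LinearMap.ext fun Y ↦ ?_)
    obtain ⟨Y₁, hY₁, Y₂, hY₂, rfl⟩ :=
      Submodule.mem_sup.1 ((H.screen_compl p).sup_eq_top.symm ▸ Submodule.mem_top (x := Y))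
    have e1 : inducedForm (F := F) g H.imm p X Y₁ = 0 := h ⟨Y₁, hY₁⟩
    have e2 : inducedForm (F := F) g H.imm p X Y₂ = 0 := by
      have : inducedForm (F := F) g H.imm p Y₂ X = 0 := by
        rw [LinearMap.mem_ker.1 hY₂]; rfl
      rw [← this]
      exact g.symm _ _ _
    rw [map_add, e1, e2]
    simp
  exact Subtype.ext ((Submodule.disjoint_def.1 (H.screen_compl p).disjoint) _ X.2 hX)

lemma screenForm_nondegenerate (p : M) : (H.screenForm p).Nondegenerate := by
  refine ⟨fun X hX ↦ H.screenForm_separating p X hX,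
    fun X hX ↦ H.screenForm_separating p X fun Y ↦ ?_⟩
  rw [← hX Y]
  exact g.symm _ _ _

variable [FiniteDimensional ℝ F]

/-- The projection `V ↦ V^*` of the ambient tangent space onto the screen, with respect to
`TN = S(TM) ⊕ S(TM)^⊥`; here `S(TM)^⊥ = rad(TM) ⊕ tr(TM)`, so it is also the projection belonging
to `TN = S(TM) ⊕ rad(TM) ⊕ tr(TM)`. The vector `V^*` is determined by `g(V^*, Y) = ḡ(V, Y)` for all
`Y` in the screen. -/
def screenProj (p : M) : TangentSpace 𝓘(ℝ, E) (H.imm p) →ₗ[ℝ] H.screen p :=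
  ((H.screenForm p).toDual (H.screenForm_nondegenerate p)).symm.toLinearMap ∘ₗ
    LinearMap.mk₂ ℝ
      (fun (v : TangentSpace 𝓘(ℝ, E) (H.imm p)) (Y : H.screen p) ↦
        g.val (H.imm p) v (H.push p Y))
      (by simp) (by simp) (by simp) (by simp)

lemma screenProj_spec (p : M) (v : TangentSpace 𝓘(ℝ, E) (H.imm p)) (Y : H.screen p) :
    g.val (H.imm p) (H.push p (H.screenProj p v)) (H.push p Y) =
      g.val (H.imm p) v (H.push p Y) :=
  LinearMap.BilinForm.apply_toDual_symm_apply (B := H.screenForm p)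
    (hB := H.screenForm_nondegenerate p) _ Y

/-- The screen component `Z^*` of a vector field `Z` along `M`, as a vector field on `M`. -/
def star (Z : ∀ p : M, TangentSpace 𝓘(ℝ, E) (H.imm p)) (p : M) : TangentSpace 𝓘(ℝ, F) p :=
  (H.screenProj p (Z p) : TangentSpace 𝓘(ℝ, F) p)

/-- The component `Z^⊥ = Z - Z^*` of `Z` in `S(TM)^⊥ = rad(TM) ⊕ tr(TM)`. -/
def perp (Z : ∀ p : M, TangentSpace 𝓘(ℝ, E) (H.imm p)) (p : M) :
    TangentSpace 𝓘(ℝ, E) (H.imm p) :=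
  Z p - H.push p (H.star Z p)

/-- The unit vector field `T = Z^*/|Z^*|` (meaningful where `Z^* ≠ 0`). -/
def unitStar (Z : ∀ p : M, TangentSpace 𝓘(ℝ, E) (H.imm p)) (p : M) : TangentSpace 𝓘(ℝ, F) p :=
  (√(H.metric p (H.star Z p) (H.star Z p)))⁻¹ • H.star Z p

variable [FiniteDimensional ℝ E]

/-- The vector field `Z` along `M` is parallel: `∇̄_X Z = 0` for all `X` tangent to `M`. -/
def IsParallelAlong (Z : ∀ p : M, TangentSpace 𝓘(ℝ, E) (H.imm p)) : Prop :=
  ∀ (p : M) (X : TangentSpace 𝓘(ℝ, F) p), g.covAlong H.imm Z p X = 0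

/-- The shape operator `A_V : S(TM) → S(TM)` of a section `V` of `S(TM)^⊥`:
`A_V X` is minus the screen component of `∇̄_X V`. -/
def shapeOp (V : ∀ p : M, TangentSpace 𝓘(ℝ, E) (H.imm p)) (p : M) :
    H.screen p →ₗ[ℝ] H.screen p :=
  -(H.screenProj p ∘ₗ g.covAlong H.imm V p ∘ₗ (H.screen p).subtype)

/-- The screen connection: `H.screenConn V p X = ∇^*_X V`, for `V` a section of `S(TM)` and
`X ∈ T_p M`, is the screen component of `∇̄_X V`. -/
def screenConn (V : ∀ p : M, TangentSpace 𝓘(ℝ, F) p) (p : M) :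
    TangentSpace 𝓘(ℝ, F) p →ₗ[ℝ] TangentSpace 𝓘(ℝ, F) p :=
  (H.screen p).subtype ∘ₗ H.screenProj p ∘ₗ g.covAlong H.imm (fun q ↦ H.push q (V q)) p

/-- The curvature of the screen connection:
`R^*(X, Y)V = ∇^*_X ∇^*_Y V - ∇^*_Y ∇^*_X V - ∇^*_{[X, Y]} V`. -/
def screenCurv (X Y V : ∀ p : M, TangentSpace 𝓘(ℝ, F) p) (p : M) : TangentSpace 𝓘(ℝ, F) p :=
  H.screenConn (fun q ↦ H.screenConn V q (Y q)) p (X p) -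
    H.screenConn (fun q ↦ H.screenConn V q (X q)) p (Y p) -
    H.screenConn V p (VectorField.mlieBracket 𝓘(ℝ, F) X Y p)

/-- `S(TM)` is flat: the curvature of the screen connection vanishes on `S(TM)`. (For an integrable
screen, this is the flatness of the leaves of `S(TM)` with their induced Riemannian metrics.) -/
def IsScreenFlat : Prop :=
  ∀ U : Set M, IsOpen U → ∀ X Y V : ∀ p : M, TangentSpace 𝓘(ℝ, F) p,
    IsSmoothSectionOn H.screen U X → IsSmoothSectionOn H.screen U Y →
      IsSmoothSectionOn H.screen U V → ∀ p ∈ U, H.screenCurv X Y V p = 0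

/-- `T`, `W` is a smooth orthonormal frame of `S(TM)` on `U` (for a screen of rank two). -/
def IsOrthonormalScreenFrameOn (U : Set M) (T W : ∀ p : M, TangentSpace 𝓘(ℝ, F) p) : Prop :=
  IsSmoothSectionOn H.screen U T ∧ IsSmoothSectionOn H.screen U W ∧
    ∀ p ∈ U, H.metric p (T p) (T p) = 1 ∧ H.metric p (W p) (W p) = 1 ∧
      H.metric p (T p) (W p) = 0

end NullHypersurface

end Null

end

/-! Split `Z = Z^* + Z^⊥`. Since `Z` is parallel, `∇̄_X Z^⊥ = -∇̄_X Z^*`, so the shape operator `A`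
of `Z^⊥` is `X ↦ ∇^*_X Z^*` (`shapeOp_perp`). Three facts force `A = 0` on the rank-two screen. (1)
In a null frame `ḡ(Z,Z) = |Z^*|² + 2 ḡ(Z,ξ) ḡ(Z,ν)` (`val_self_eq`). As `ḡ(Z,Z)` has zero derivative
and the angle is constant, so has `|Z^*|²`; hence `∇^*_X T = |Z^*|⁻¹ A X` (`screenConn_unitStar`),
and `A X ⊥ T` because `T` is a unit field. (2) Differentiating `ḡ(Z^⊥, Y) = 0` gives `g(A X, Y) =
ḡ(Z^⊥, ∇̄_X Y)`. Zero torsion and integrability of the screen make this symmetric in `X`, `Y`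
(`metric_screenConn_star_comm`). (3) `tr A = 0`. By (1) only `g(A T, W)` and `g(A W, W)` can be
nonzero; (2) turns the first into `g(A W, T) = 0`, and (3) kills the second. So `T` is parallel
along the screen, and then so is `W`, because the screen connection is metric
(`screenConn_frame_eq_zero`). Flatness follows by writing a section as `a T + b W`: the curvature
only sees `X(Y a) - Y(X a) - [X,Y] a = 0`, and likewise for `b` (`isScreenFlat_of_parallel_frame`).
The connection is given by Christoffel symbols in charts, so its metric compatibility
(`mvfderiv_val`) and zero torsion (`covAlong_mfderiv_sub`) are derived along maps, the latter from
the bracket identity `mvfderiv_mlieBracket`. -/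

open Filter

noncomputable section

/-! ### Differentials of vector-valued functions and the Lie bracket as a commutator. -/

section Bracket

variable {F : Type*} [NormedAddCommGroup F] [NormedSpace ℝ F]
  {M : Type*} [TopologicalSpace M] [ChartedSpace F M]
  {F' : Type*} [NormedAddCommGroup F'] [NormedSpace ℝ F']
  {M' : Type*} [TopologicalSpace M'] [ChartedSpace F' M']
  {G : Type*} [NormedAddCommGroup G] [NormedSpace ℝ G]

lemma Filter.EventuallyEq.mvfderiv_eq {f h : M → G} {p : M} (hfh : f =ᶠ[𝓝 p] h) :
    mvfderiv 𝓘(ℝ, F) f p = mvfderiv 𝓘(ℝ, F) h p := by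
  ext v
  simp only [mvfderiv]
  exact DFunLike.congr_fun (hfh.mfderiv_eq (I := 𝓘(ℝ, F)) (I' := 𝓘(ℝ, G))) v

lemma mvfderiv_comp_mfderiv_apply {f : M' → G} {h : M → M'} {p : M}
    (hf : MDifferentiableAt 𝓘(ℝ, F') 𝓘(ℝ, G) f (h p))
    (hh : MDifferentiableAt 𝓘(ℝ, F) 𝓘(ℝ, F') h p) (v : TangentSpace 𝓘(ℝ, F) p) :
    mvfderiv 𝓘(ℝ, F) (fun q ↦ f (h q)) p v =
      mvfderiv 𝓘(ℝ, F') f (h p) (mfderiv 𝓘(ℝ, F) 𝓘(ℝ, F') h p v) :=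
  mfderiv_comp_apply p hf hh v

lemma mvfderiv_fderiv_comp_apply {G' : Type*} [NormedAddCommGroup G'] [NormedSpace ℝ G']
    {f : G → G'} {h : M → G} {p : M} (hf : DifferentiableAt ℝ f (h p))
    (hh : MDifferentiableAt 𝓘(ℝ, F) 𝓘(ℝ, G) h p) (v : TangentSpace 𝓘(ℝ, F) p) :
    mvfderiv 𝓘(ℝ, F) (fun q ↦ f (h q)) p v = fderiv ℝ f (h p) (mvfderiv 𝓘(ℝ, F) h p v) := by
  have := mfderiv_comp_apply (I := 𝓘(ℝ, F)) (I' := 𝓘(ℝ, G)) (I'' := 𝓘(ℝ, G')) p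
    hf.mdifferentiableAt hh v
  rw [mfderiv_eq_fderiv] at this
  exact this

/-- The tangent space at `p` is identified with the model space through the chart at `p`, so no
coordinate change appears. This carries rules of Fréchet calculus over to `mvfderiv`. -/
lemma MDifferentiableAt.mvfderiv_eq_fderiv {f : M → G} {p : M}
    (hf : MDifferentiableAt 𝓘(ℝ, F) 𝓘(ℝ, G) f p) :
    DifferentiableAt ℝ (f ∘ (extChartAt 𝓘(ℝ, F) p).symm) (extChartAt 𝓘(ℝ, F) p p) ∧
    mvfderiv 𝓘(ℝ, F) f p =
      fderiv ℝ (f ∘ (extChartAt 𝓘(ℝ, F) p).symm) (extChartAt 𝓘(ℝ, F) p p) := by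
  have h1 := hf.mvfderiv
  simp only [writtenInExtChartAt, extChartAt_model_space_eq_id,
    modelWithCornersSelf_coe, range_id, fderivWithin_univ] at h1
  refine ⟨?_, h1⟩
  have h3 := (mdifferentiableAt_iff (I := 𝓘(ℝ, F)) (I' := 𝓘(ℝ, G)) f p).1 hf |>.2
  simp only [writtenInExtChartAt, extChartAt_model_space_eq_id, modelWithCornersSelf_coe,
    range_id, differentiableWithinAt_univ] at h3
  exact h3

lemma mvfderiv_clm_apply {G' : Type*} [NormedAddCommGroup G'] [NormedSpace ℝ G']
    {c : M → G →L[ℝ] G'} {h : M → G} {p : M} (hc : MDifferentiableAt 𝓘(ℝ, F) 𝓘(ℝ, G →L[ℝ] G') c p)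
    (hh : MDifferentiableAt 𝓘(ℝ, F) 𝓘(ℝ, G) h p) (v : TangentSpace 𝓘(ℝ, F) p) :
    mvfderiv 𝓘(ℝ, F) (fun q ↦ c q (h q)) p v =
      mvfderiv 𝓘(ℝ, F) c p v (h p) + c p (mvfderiv 𝓘(ℝ, F) h p v) := by
  have hch : MDifferentiableAt 𝓘(ℝ, F) 𝓘(ℝ, G') (fun q ↦ c q (h q)) p := hc.clm_apply hh
  obtain ⟨h1, e1⟩ := hc.mvfderiv_eq_fderiv
  obtain ⟨h2, e2⟩ := hh.mvfderiv_eq_fderiv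
  rw [hch.mvfderiv_eq_fderiv.2, e1, e2]
  have := congrArg (fun L : F →L[ℝ] G' ↦ L v) (fderiv_clm_apply h1 h2)
  simp only [Function.comp_apply, extChartAt_to_inv] at this
  refine Eq.trans this ?_
  rw [add_comm]
  rfl

lemma ContMDiffAt.contDiffAt_comp_extChartAt_symm {f : M → G} {p : M}
    (hf : ContMDiffAt 𝓘(ℝ, F) 𝓘(ℝ, G) ∞ f p) :
    ContDiffAt ℝ ∞ (f ∘ (extChartAt 𝓘(ℝ, F) p).symm) (extChartAt 𝓘(ℝ, F) p p) := by
  have := (contMDiffAt_iff.1 hf).2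
  rw [modelWithCornersSelf_coe, range_id, contDiffWithinAt_univ, extChartAt_model_space_eq_id]
    at this
  exact this

lemma ContMDiffAt.differentiableAt_fderiv_comp_extChartAt_symm {f : M → G} {p : M}
    (hf : ContMDiffAt 𝓘(ℝ, F) 𝓘(ℝ, G) ∞ f p) :
    DifferentiableAt ℝ (fderiv ℝ (f ∘ (extChartAt 𝓘(ℝ, F) p).symm))
      (extChartAt 𝓘(ℝ, F) p p) :=
  (hf.contDiffAt_comp_extChartAt_symm.fderiv_right (m := 1) (by norm_cast)).differentiableAt
    (by simp)

variable [IsManifold 𝓘(ℝ, F) ∞ M]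

/-- The expression of a differential in the chart at `p`. -/
lemma mvfderiv_eq_fderiv_chart {f : M → G} {p q : M} (hq : q ∈ (extChartAt 𝓘(ℝ, F) p).source)
    (hf : MDifferentiableAt 𝓘(ℝ, F) 𝓘(ℝ, G) f q) (X : ∀ q : M, TangentSpace 𝓘(ℝ, F) q) :
    mvfderiv 𝓘(ℝ, F) f q (X q) =
      fderiv ℝ (f ∘ (extChartAt 𝓘(ℝ, F) p).symm) (extChartAt 𝓘(ℝ, F) p q)
        (VectorField.mpullbackWithin 𝓘(ℝ, F) 𝓘(ℝ, F) (extChartAt 𝓘(ℝ, F) p).symm X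
          (range 𝓘(ℝ, F)) (extChartAt 𝓘(ℝ, F) p q)) := by
  set φ := extChartAt 𝓘(ℝ, F) p with hφ
  have hsymm : φ.symm (φ q) = q := φ.left_inv hq
  have ht : φ q ∈ φ.target := φ.map_source hq
  have hinv := isInvertible_mfderivWithin_extChartAt_symm (I := 𝓘(ℝ, F)) ht
  rw [VectorField.mpullbackWithin_apply]
  simp only [modelWithCornersSelf_coe, range_id, mfderivWithin_univ] at hinv ⊢
  have hd : MDifferentiableAt 𝓘(ℝ, F) 𝓘(ℝ, F) φ.symm (φ q) :=
    mdifferentiableAt_of_isInvertible_mfderiv hinv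
  -- The pulled-back field is the inverse of the differential of `φ.symm` applied to `X`; the chain
  -- rule for `f ∘ φ.symm` cancels that inverse.
  have hc := mfderiv_comp_apply (I := 𝓘(ℝ, F)) (I' := 𝓘(ℝ, F)) (I'' := 𝓘(ℝ, G)) (φ q)
    (g := f) (f := φ.symm) (by rwa [hsymm]) hd
    ((mfderiv 𝓘(ℝ, F) 𝓘(ℝ, F) φ.symm (φ q)).inverse (X (φ.symm (φ q))))
  rw [mfderiv_eq_fderiv, hinv.self_apply_inverse] at hc
  refine Eq.trans ?_ hc.symm
  change mvfderiv 𝓘(ℝ, F) f q (X q) = mvfderiv 𝓘(ℝ, F) f (φ.symm (φ q)) (X (φ.symm (φ q)))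
  rw [hsymm]

lemma differentiableAt_mpullbackWithin_extChartAt_symm [CompleteSpace F] {p : M}
    {X : ∀ q : M, TangentSpace 𝓘(ℝ, F) q}
    (hX : MDifferentiableAt 𝓘(ℝ, F) 𝓘(ℝ, F).tangent
      (fun q ↦ (⟨q, X q⟩ : TangentBundle 𝓘(ℝ, F) M)) p) :
    DifferentiableAt ℝ (show F → F from VectorField.mpullbackWithin 𝓘(ℝ, F) 𝓘(ℝ, F)
      (extChartAt 𝓘(ℝ, F) p).symm X (range 𝓘(ℝ, F))) (extChartAt 𝓘(ℝ, F) p p) := by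
  set hat : F → F := VectorField.mpullbackWithin 𝓘(ℝ, F) 𝓘(ℝ, F)
    (extChartAt 𝓘(ℝ, F) p).symm X (range 𝓘(ℝ, F))
  have : DifferentiableWithinAt ℝ hat ((extChartAt 𝓘(ℝ, F) p).symm ⁻¹' univ ∩ range 𝓘(ℝ, F))
      (extChartAt 𝓘(ℝ, F) p p) :=
    MDifferentiableWithinAt.differentiableWithinAt_mpullbackWithin_vectorField (s := univ)
      hX.mdifferentiableWithinAt
  rwa [modelWithCornersSelf_coe, range_id, preimage_univ, inter_univ,
    differentiableWithinAt_univ] at this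

lemma ContMDiffAt.eventually_mdifferentiableAt {f : M → G} {p : M}
    (hf : ContMDiffAt 𝓘(ℝ, F) 𝓘(ℝ, G) ∞ f p) :
    ∀ᶠ q in 𝓝 p, MDifferentiableAt 𝓘(ℝ, F) 𝓘(ℝ, G) f q := by
  have h1 : ContMDiffAt 𝓘(ℝ, F) 𝓘(ℝ, G) 1 f p := hf.of_le (by norm_cast)
  filter_upwards [(contMDiffAt_iff_contMDiffAt_nhds (by simp)).1 h1] with q hq using
    hq.mdifferentiableAt one_ne_zero

/-- The derivative of a smooth function along a differentiable vector field is differentiable. -/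
lemma ContMDiffAt.mdifferentiableAt_mvfderiv_apply [CompleteSpace F] {f : M → G} {p : M}
    {X : ∀ q : M, TangentSpace 𝓘(ℝ, F) q}
    (hf : ContMDiffAt 𝓘(ℝ, F) 𝓘(ℝ, G) ∞ f p)
    (hX : MDifferentiableAt 𝓘(ℝ, F) 𝓘(ℝ, F).tangent
      (fun q ↦ (⟨q, X q⟩ : TangentBundle 𝓘(ℝ, F) M)) p) :
    MDifferentiableAt 𝓘(ℝ, F) 𝓘(ℝ, G) (fun q ↦ mvfderiv 𝓘(ℝ, F) f q (X q)) p := by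
  have h2 := hf.differentiableAt_fderiv_comp_extChartAt_symm.clm_apply
    (differentiableAt_mpullbackWithin_extChartAt_symm hX)
  refine (h2.mdifferentiableAt.comp p
    (mdifferentiableAt_extChartAt (mem_chart_source F p))).congr_of_eventuallyEq ?_
  filter_upwards [extChartAt_source_mem_nhds (I := 𝓘(ℝ, F)) p,
    hf.eventually_mdifferentiableAt] with q hq hq' using mvfderiv_eq_fderiv_chart hq hq' X

/-- The Lie bracket is the commutator of the derivations defined by vector fields, here acting on
vector-valued functions. -/
theorem mvfderiv_mlieBracket [CompleteSpace F] {f : M → G} {p : M}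
    {X Y : ∀ q : M, TangentSpace 𝓘(ℝ, F) q}
    (hf : ContMDiffAt 𝓘(ℝ, F) 𝓘(ℝ, G) ∞ f p)
    (hX : MDifferentiableAt 𝓘(ℝ, F) 𝓘(ℝ, F).tangent
      (fun q ↦ (⟨q, X q⟩ : TangentBundle 𝓘(ℝ, F) M)) p)
    (hY : MDifferentiableAt 𝓘(ℝ, F) 𝓘(ℝ, F).tangent
      (fun q ↦ (⟨q, Y q⟩ : TangentBundle 𝓘(ℝ, F) M)) p) :
    mvfderiv 𝓘(ℝ, F) (fun q ↦ mvfderiv 𝓘(ℝ, F) f q (Y q)) p (X p) -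
      mvfderiv 𝓘(ℝ, F) (fun q ↦ mvfderiv 𝓘(ℝ, F) f q (X q)) p (Y p) =
      mvfderiv 𝓘(ℝ, F) f p (VectorField.mlieBracket 𝓘(ℝ, F) X Y p) := by
  set φ := extChartAt 𝓘(ℝ, F) p with hφ
  have hsrc : ∀ᶠ q in 𝓝 p, q ∈ φ.source := extChartAt_source_mem_nhds p
  have hfd := hf.eventually_mdifferentiableAt
  set D : F → F →L[ℝ] G := fderiv ℝ (f ∘ φ.symm) with hD
  have hcd := hf.contDiffAt_comp_extChartAt_symm
  have hDd : DifferentiableAt ℝ D (φ p) := hf.differentiableAt_fderiv_comp_extChartAt_symm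
  set hat : (∀ q : M, TangentSpace 𝓘(ℝ, F) q) → F → F := fun X ↦
    VectorField.mpullbackWithin 𝓘(ℝ, F) 𝓘(ℝ, F) φ.symm X (range 𝓘(ℝ, F)) with hhat
  have hatd (X : ∀ q : M, TangentSpace 𝓘(ℝ, F) q)
      (hX : MDifferentiableAt 𝓘(ℝ, F) 𝓘(ℝ, F).tangent
        (fun q ↦ (⟨q, X q⟩ : TangentBundle 𝓘(ℝ, F) M)) p) : DifferentiableAt ℝ (hat X) (φ p) :=
    differentiableAt_mpullbackWithin_extChartAt_symm hX
  have hφd : MDifferentiableAt 𝓘(ℝ, F) 𝓘(ℝ, F) φ p :=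
    mdifferentiableAt_extChartAt (mem_chart_source F p)
  -- In the chart, `X(Y f)` is a second derivative of `f` in the directions of both fields plus `D`
  -- applied to the derivative of `Y` along `X`. The first term is symmetric and drops out of the
  -- commutator; the second terms assemble to the bracket.
  have hderiv (X Y : ∀ q : M, TangentSpace 𝓘(ℝ, F) q)
      (hY : MDifferentiableAt 𝓘(ℝ, F) 𝓘(ℝ, F).tangent
        (fun q ↦ (⟨q, Y q⟩ : TangentBundle 𝓘(ℝ, F) M)) p) :
      mvfderiv 𝓘(ℝ, F) (fun q ↦ mvfderiv 𝓘(ℝ, F) f q (Y q)) p (X p) =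
        fderiv ℝ D (φ p) (hat X (φ p)) (hat Y (φ p)) +
          D (φ p) (fderiv ℝ (hat Y) (φ p) (hat X (φ p))) := by
    have h1 : (fun q ↦ mvfderiv 𝓘(ℝ, F) f q (Y q)) =ᶠ[𝓝 p]
        fun q ↦ (fun z ↦ D z (hat Y z)) (φ q) := by
      filter_upwards [hsrc, hfd] with q hq hq' using mvfderiv_eq_fderiv_chart hq hq' Y
    have h2 : DifferentiableAt ℝ (fun z ↦ D z (hat Y z)) (φ p) := hDd.clm_apply (hatd Y hY)
    have h3 : mvfderiv 𝓘(ℝ, F) φ p (X p) = hat X (φ p) := by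
      rw [mvfderiv_eq_fderiv_chart (mem_extChartAt_source p) hφd X]
      have : (φ ∘ φ.symm) =ᶠ[𝓝 (φ p)] id := by
        filter_upwards [extChartAt_target_mem_nhds (I := 𝓘(ℝ, F)) p] with z hz using φ.right_inv hz
      rw [← hφ, this.fderiv_eq, fderiv_id]
      rfl
    rw [h1.mvfderiv_eq, mvfderiv_fderiv_comp_apply h2 hφd, h3, fderiv_clm_apply hDd (hatd Y hY)]
    simp only [add_apply, ContinuousLinearMap.comp_apply, ContinuousLinearMap.flip_apply]
    exact add_comm _ _
  have hbr : mvfderiv 𝓘(ℝ, F) f p (VectorField.mlieBracket 𝓘(ℝ, F) X Y p) =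
      D (φ p) (VectorField.lieBracket ℝ (hat X) (hat Y) (φ p)) := by
    have hinv : (mfderiv 𝓘(ℝ, F) 𝓘(ℝ, F) φ p).IsInvertible :=
      isInvertible_mfderiv_extChartAt (mem_extChartAt_source p)
    have h1 : VectorField.mlieBracket 𝓘(ℝ, F) X Y p = (mfderiv 𝓘(ℝ, F) 𝓘(ℝ, F) φ p).inverse
        (show F from VectorField.lieBracket ℝ (hat X) (hat Y) (φ p)) := by
      rw [← VectorField.lieBracketWithin_univ (V := hat X)]
      -- This is the set over which `mlieBracket` takes its chart bracket; with it the two sides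
      -- agree by definition.
      have : (univ : Set F) = φ.symm ⁻¹' univ ∩ range 𝓘(ℝ, F) := by simp
      rw [this]
      rfl
    have hfφ : f =ᶠ[𝓝 p] fun q ↦ (f ∘ φ.symm) (φ q) := by
      filter_upwards [hsrc] with q hq
      simp [φ.left_inv hq]
    rw [hfφ.mvfderiv_eq, mvfderiv_fderiv_comp_apply (hcd.differentiableAt (by simp)) hφd, h1]
    congr 1
    exact hinv.self_apply_inverse _
  have hsymm : IsSymmSndFDerivAt ℝ (f ∘ φ.symm) (φ p) :=
    hcd.isSymmSndFDerivAt (by simpa using WithTop.coe_le_coe.2 (le_top (a := (2 : ℕ∞))))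
  rw [hderiv X Y hY, hderiv Y X hX, hbr, VectorField.lieBracket, map_sub,
    hsymm.eq (hat X (φ p)) (hat Y (φ p))]
  abel

end Bracket

/-! ### The Levi-Civita connection along a map: linearity, metric compatibility, zero torsion. -/

section LeviCivita

variable {E : Type*} [NormedAddCommGroup E] [NormedSpace ℝ E]
  {N : Type*} [TopologicalSpace N] [ChartedSpace E N] [IsManifold 𝓘(ℝ, E) ∞ N]
  {F : Type*} [NormedAddCommGroup F] [NormedSpace ℝ F]
  {M : Type*} [TopologicalSpace M] [ChartedSpace F M]

/-- Components, in the preferred chart around `x₀`, of tangent vectors at `x`. -/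
def tangentCoord (x₀ x : N) : TangentSpace 𝓘(ℝ, E) x →L[ℝ] E :=
  (trivializationAt E (TangentSpace 𝓘(ℝ, E)) x₀).continuousLinearMapAt ℝ x

lemma tangentCoord_apply {x₀ x : N} (hx : x ∈ (chartAt E x₀).source)
    (v : TangentSpace 𝓘(ℝ, E) x) :
    tangentCoord x₀ x v =
      (trivializationAt E (TangentSpace 𝓘(ℝ, E)) x₀ (⟨x, v⟩ : TangentBundle 𝓘(ℝ, E) N)).2 :=
  Trivialization.continuousLinearMapAt_apply_of_mem _ _ hx v

lemma tangentCoord_self (x₀ : N) (v : TangentSpace 𝓘(ℝ, E) x₀) : tangentCoord x₀ x₀ v = v :=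
  (congrArg (fun L : E →L[ℝ] E ↦ L v)
    (TangentBundle.continuousLinearMapAt_trivializationAt_eq_core (I := 𝓘(ℝ, E))
      (mem_chart_source E x₀))).trans
    ((tangentBundleCore 𝓘(ℝ, E) N).coordChange_self (achart E x₀) x₀ (mem_chart_source E x₀) v)

lemma symmL_tangentCoord {x₀ x : N} (hx : x ∈ (chartAt E x₀).source)
    (v : TangentSpace 𝓘(ℝ, E) x) :
    (trivializationAt E (TangentSpace 𝓘(ℝ, E)) x₀).symmL ℝ x (tangentCoord x₀ x v) = v :=
  Trivialization.symmL_continuousLinearMapAt _ hx v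

lemma tangentCoord_eq_mfderiv {x₀ x : N} (hx : x ∈ (chartAt E x₀).source)
    (v : TangentSpace 𝓘(ℝ, E) x) :
    tangentCoord x₀ x v = mfderiv 𝓘(ℝ, E) 𝓘(ℝ, E) (extChartAt 𝓘(ℝ, E) x₀) x v :=
  congrArg (fun L : TangentSpace 𝓘(ℝ, E) x →L[ℝ] E ↦ L v)
    (TangentBundle.continuousLinearMapAt_trivializationAt hx)

/-- The vector field `V` along `f` is differentiable at `p`. -/
def MDiffAlongAt (f : M → N) (V : ∀ q : M, TangentSpace 𝓘(ℝ, E) (f q)) (p : M) : Prop :=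
  MDifferentiableAt 𝓘(ℝ, F) 𝓘(ℝ, E).tangent
    (fun q ↦ (⟨f q, V q⟩ : TangentBundle 𝓘(ℝ, E) N)) p

variable {f : M → N} {V W : ∀ q : M, TangentSpace 𝓘(ℝ, E) (f q)} {p : M}

/-- Near `p` the points `f q` stay in one chart domain, where the fibre coordinate is
`tangentCoord`. As this is linear on fibres, calculus with fields along `f` reduces to calculus with
`E`-valued functions. -/
lemma mdiffAlongAt_iff :
    MDiffAlongAt (F := F) f V p ↔ MDifferentiableAt 𝓘(ℝ, F) 𝓘(ℝ, E) f p ∧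
      MDifferentiableAt 𝓘(ℝ, F) 𝓘(ℝ, E) (fun q ↦ tangentCoord (f p) (f q) (V q)) p := by
  refine (mdifferentiableAt_totalSpace 𝓘(ℝ, E) _).trans ?_
  refine and_congr_right fun h ↦ Filter.EventuallyEq.mdifferentiableAt_iff ?_
  filter_upwards [h.continuousAt (chart_source_mem_nhds E (f p))] with q hq using
    (tangentCoord_apply hq _).symm

lemma MDiffAlongAt.sub (hV : MDiffAlongAt (F := F) f V p) (hW : MDiffAlongAt (F := F) f W p) :
    MDiffAlongAt (F := F) f (fun q ↦ V q - W q) p := by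
  rw [mdiffAlongAt_iff] at hV hW ⊢
  exact ⟨hV.1, by simp only [map_sub]; exact hV.2.sub hW.2⟩

lemma MDiffAlongAt.smul {a : M → ℝ} (hV : MDiffAlongAt (F := F) f V p)
    (ha : MDifferentiableAt 𝓘(ℝ, F) 𝓘(ℝ, ℝ) a p) :
    MDiffAlongAt (F := F) f (fun q ↦ a q • V q) p := by
  rw [mdiffAlongAt_iff] at hV ⊢
  exact ⟨hV.1, by simp only [map_smul]; exact ha.smul hV.2⟩

variable (f V p) in
/-- The derivative at `p` of the components of the vector field `V` along `f` in the preferred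
chart around `f p`. -/
def coordDeriv : TangentSpace 𝓘(ℝ, F) p →L[ℝ] TangentSpace 𝓘(ℝ, E) (f p) :=
  mvfderiv 𝓘(ℝ, F) (fun q ↦ tangentCoord (f p) (f q) (V q)) p

lemma coordDeriv_add (hV : MDiffAlongAt (F := F) f V p) (hW : MDiffAlongAt (F := F) f W p)
    (X : TangentSpace 𝓘(ℝ, F) p) :
    coordDeriv f (fun q ↦ V q + W q) p X = coordDeriv f V p X + coordDeriv f W p X := by
  have := congrArg (fun L : TangentSpace 𝓘(ℝ, F) p →L[ℝ] E ↦ L X)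
    (mvfderiv_fun_add (mdiffAlongAt_iff.1 hV).2 (mdiffAlongAt_iff.1 hW).2)
  simpa only [coordDeriv, map_add] using! this

lemma coordDeriv_smul {a : M → ℝ} (ha : MDifferentiableAt 𝓘(ℝ, F) 𝓘(ℝ, ℝ) a p)
    (hV : MDiffAlongAt (F := F) f V p) (X : TangentSpace 𝓘(ℝ, F) p) :
    coordDeriv f (fun q ↦ a q • V q) p X =
      mvfderiv 𝓘(ℝ, F) a p X • V p + a p • coordDeriv f V p X := by
  have h1 := congrArg (fun L : TangentSpace 𝓘(ℝ, F) p →L[ℝ] E ↦ L X)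
    (mvfderiv_fun_smul ha (mdiffAlongAt_iff.1 hV).2)
  have h2 : (mvfderiv 𝓘(ℝ, F) a p X • tangentCoord (f p) (f p) (V p) : E) =
    (show TangentSpace 𝓘(ℝ, E) (f p) from mvfderiv 𝓘(ℝ, F) a p X • V p) :=
    congrArg (fun v : E ↦ mvfderiv 𝓘(ℝ, F) a p X • v) (tangentCoord_self (f p) (V p))
  simp only [coordDeriv, map_smul]
  refine h1.trans (Eq.trans ?_ (add_comm _ _))
  exact congrArg (fun v : E ↦ (a p • mvfderiv 𝓘(ℝ, F)
    (fun q ↦ tangentCoord (f p) (f q) (V q)) p X : E) + v) h2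

namespace LorentzMetric

variable (g : LorentzMetric E N)

/-- Smoothness of the metric as a section of a bundle of bilinear maps is smoothness of its
expression in trivializations, which is `coeff` on the chart domain. -/
lemma contMDiffAt_coeff (x₀ : N) :
    ContMDiffAt 𝓘(ℝ, E) 𝓘(ℝ, E →L[ℝ] E →L[ℝ] ℝ) ∞ (g.coeff x₀) x₀ := by
  have h := ((contMDiffAt_hom_bundle _).1 (g.contMDiff x₀)).2
  refine h.congr_of_eventuallyEq ?_
  filter_upwards [chart_source_mem_nhds E x₀] with x hx
  ext u v
  rw [inCoordinates_apply_eq₂ hx hx (mem_univ _)]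
  simp only [Trivial.fiberBundle_trivializationAt', Trivial.linearMapAt_trivialization,
    LinearMap.id_apply, coeff_apply]
  rw [Trivialization.symmL_apply _ hx, Trivialization.symmL_apply _ hx]

lemma coeff_tangentCoord {x₀ x : N} (hx : x ∈ (chartAt E x₀).source)
    (v w : TangentSpace 𝓘(ℝ, E) x) :
    g.coeff x₀ x (tangentCoord x₀ x v) (tangentCoord x₀ x w) = g.val x v w := by
  rw [coeff_apply, symmL_tangentCoord hx, symmL_tangentCoord hx]

lemma coeff_symm (x₀ x : N) (v w : E) : g.coeff x₀ x v w = g.coeff x₀ x w v := by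
  rw [coeff_apply, coeff_apply, g.symm]

lemma dcoeff_apply (x₀ : N) (u v w : E) :
    g.dcoeff x₀ u v w = mvfderiv 𝓘(ℝ, E) (fun x ↦ g.coeff x₀ x v w) x₀ u := by
  have h1 := (g.contMDiffAt_coeff x₀).mdifferentiableAt (by simp)
  have h2 : MDifferentiableAt 𝓘(ℝ, E) 𝓘(ℝ, E →L[ℝ] ℝ) (fun x ↦ g.coeff x₀ x v) x₀ :=
    h1.clm_apply mdifferentiableAt_const
  have e1 := mvfderiv_clm_apply h2 (mdifferentiableAt_const (c := w)) u
  have e2 := mvfderiv_clm_apply h1 (mdifferentiableAt_const (c := v)) u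
  rw [mvfderiv_const] at e1 e2
  have e3 (L : E →L[ℝ] ℝ) : L ((0 : TangentSpace 𝓘(ℝ, E) x₀ →L[ℝ] E) u) = 0 := L.map_zero
  have e4 (L : E →L[ℝ] E →L[ℝ] ℝ) : L ((0 : TangentSpace 𝓘(ℝ, E) x₀ →L[ℝ] E) u) = 0 := L.map_zero
  rw [e3, add_zero, e2, e4, add_zero] at e1
  exact e1.symm

lemma dcoeff_symm (x₀ : N) (u v w : E) : g.dcoeff x₀ u v w = g.dcoeff x₀ u w v := by
  simp only [dcoeff_apply, g.coeff_symm x₀ _ v w]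

variable [FiniteDimensional ℝ E]

lemma christoffel_spec (x : N) (u v w : TangentSpace 𝓘(ℝ, E) x) :
    g.val x (g.christoffel x v u) w =
      (1 / 2 : ℝ) * (g.dcoeff x u v w + g.dcoeff x v u w - g.dcoeff x w u v) :=
  LinearMap.BilinForm.apply_toDual_symm_apply (B := g.form x)
    (hB := g.form_nondegenerate x) _ w

/-- Besides giving zero torsion, this supplies linearity in the argument `v`, which the definition
of `christoffel` does not bundle. -/
lemma christoffel_symm (x : N) (u v : TangentSpace 𝓘(ℝ, E) x) :
    g.christoffel x v u = g.christoffel x u v := by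
  rw [← sub_eq_zero]
  refine g.eq_zero_of_forall x _ fun w ↦ ?_
  rw [map_sub, sub_apply, christoffel_spec, christoffel_spec]
  rw [g.dcoeff_symm x w u v]
  ring

lemma covAlong_congr (h : V =ᶠ[𝓝 p] W) : g.covAlong (F := F) f V p = g.covAlong f W p := by
  ext X
  have h1 : (fun q ↦ (trivializationAt E (TangentSpace 𝓘(ℝ, E)) (f p)
      (⟨f q, V q⟩ : TangentBundle 𝓘(ℝ, E) N)).2) =ᶠ[𝓝 p]
      fun q ↦ (trivializationAt E (TangentSpace 𝓘(ℝ, E)) (f p)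
        (⟨f q, W q⟩ : TangentBundle 𝓘(ℝ, E) N)).2 := by
    filter_upwards [h] with q hq
    rw [hq]
  simp only [covAlong, LinearMap.coe_mk, AddHom.coe_mk]
  rw [h1.mvfderiv_eq, h.eq_of_nhds]

lemma covAlong_apply (hf : ContinuousAt f p) (X : TangentSpace 𝓘(ℝ, F) p) :
    g.covAlong f V p X = coordDeriv f V p X +
      g.christoffel (f p) (V p) (mfderiv 𝓘(ℝ, F) 𝓘(ℝ, E) f p X) := by
  have h1 : (fun q ↦ (trivializationAt E (TangentSpace 𝓘(ℝ, E)) (f p)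
      (⟨f q, V q⟩ : TangentBundle 𝓘(ℝ, E) N)).2) =ᶠ[𝓝 p]
      fun q ↦ tangentCoord (f p) (f q) (V q) := by
    filter_upwards [hf (chart_source_mem_nhds E (f p))] with q hq using (tangentCoord_apply hq _).symm
  simp only [covAlong, LinearMap.coe_mk, AddHom.coe_mk]
  rw [h1.mvfderiv_eq]
  rfl

lemma christoffel_add (x : N) (u v w : TangentSpace 𝓘(ℝ, E) x) :
    g.christoffel x (v + w) u = g.christoffel x v u + g.christoffel x w u := by
  rw [christoffel_symm, map_add, christoffel_symm, christoffel_symm g x u w]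

lemma christoffel_smul (x : N) (c : ℝ) (u v : TangentSpace 𝓘(ℝ, E) x) :
    g.christoffel x (c • v) u = c • g.christoffel x v u := by
  rw [christoffel_symm, map_smul, christoffel_symm]

lemma covAlong_add (hV : MDiffAlongAt (F := F) f V p) (hW : MDiffAlongAt (F := F) f W p)
    (X : TangentSpace 𝓘(ℝ, F) p) :
    g.covAlong f (fun q ↦ V q + W q) p X = g.covAlong f V p X + g.covAlong f W p X := by
  have hc := (mdiffAlongAt_iff.1 hV).1.continuousAt
  rw [g.covAlong_apply hc, g.covAlong_apply hc, g.covAlong_apply hc, christoffel_add,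
    coordDeriv_add hV hW]
  exact add_add_add_comm _ _ _ _

lemma covAlong_sub (hV : MDiffAlongAt (F := F) f V p) (hW : MDiffAlongAt (F := F) f W p)
    (X : TangentSpace 𝓘(ℝ, F) p) :
    g.covAlong f (fun q ↦ V q - W q) p X = g.covAlong f V p X - g.covAlong f W p X := by
  rw [eq_sub_iff_add_eq, ← g.covAlong_add (hV.sub hW) hW]
  simp only [sub_add_cancel]

lemma covAlong_smul {a : M → ℝ} (ha : MDifferentiableAt 𝓘(ℝ, F) 𝓘(ℝ, ℝ) a p)
    (hV : MDiffAlongAt (F := F) f V p) (X : TangentSpace 𝓘(ℝ, F) p) :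
    g.covAlong f (fun q ↦ a q • V q) p X =
      mvfderiv 𝓘(ℝ, F) a p X • V p + a p • g.covAlong f V p X := by
  have hc := (mdiffAlongAt_iff.1 hV).1.continuousAt
  rw [g.covAlong_apply hc, g.covAlong_apply hc, christoffel_smul, coordDeriv_smul ha hV, smul_add,
    add_assoc]

/-- The Levi-Civita connection along a map is compatible with the metric. -/
theorem mvfderiv_val (hV : MDiffAlongAt (F := F) f V p) (hW : MDiffAlongAt (F := F) f W p)
    (X : TangentSpace 𝓘(ℝ, F) p) :
    mvfderiv 𝓘(ℝ, F) (fun q ↦ g.val (f q) (V q) (W q)) p X =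
      g.val (f p) (g.covAlong f V p X) (W p) + g.val (f p) (V p) (g.covAlong f W p X) := by
  obtain ⟨hf, hV'⟩ := mdiffAlongAt_iff.1 hV
  obtain ⟨-, hW'⟩ := mdiffAlongAt_iff.1 hW
  have hc := hf.continuousAt
  have hcoeff := (g.contMDiffAt_coeff (f p)).mdifferentiableAt (by simp)
  have hcf : MDifferentiableAt 𝓘(ℝ, F) 𝓘(ℝ, E →L[ℝ] E →L[ℝ] ℝ) (fun q ↦ g.coeff (f p) (f q)) p :=
    hcoeff.comp p hf
  have h1 : (fun q ↦ g.val (f q) (V q) (W q)) =ᶠ[𝓝 p] fun q ↦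
      g.coeff (f p) (f q) (tangentCoord (f p) (f q) (V q)) (tangentCoord (f p) (f q) (W q)) := by
    filter_upwards [hc (chart_source_mem_nhds E (f p))] with q hq using
      (g.coeff_tangentCoord hq _ _).symm
  have h2 (v w : TangentSpace 𝓘(ℝ, E) (f p)) : g.coeff (f p) (f p) v w = g.val (f p) v w := by
    have := g.coeff_tangentCoord (mem_chart_source E (f p)) v w
    rwa [tangentCoord_self, tangentCoord_self] at this
  -- Product rule in the chart: one term differentiates the metric coefficients, the other two the
  -- components of the fields.
  have h3 : mvfderiv 𝓘(ℝ, F) (fun q ↦ g.val (f q) (V q) (W q)) p X =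
      g.dcoeff (f p) (mfderiv 𝓘(ℝ, F) 𝓘(ℝ, E) f p X) (V p) (W p) +
        g.val (f p) (coordDeriv f V p X) (W p) + g.val (f p) (V p) (coordDeriv f W p X) := by
    rw [h1.mvfderiv_eq, mvfderiv_clm_apply (hcf.clm_apply hV') hW', mvfderiv_clm_apply hcf hV',
      mvfderiv_comp_mfderiv_apply hcoeff hf, ← h2, ← h2, tangentCoord_self, tangentCoord_self]
    rfl
  rw [h3, g.covAlong_apply hc, g.covAlong_apply hc, map_add,
    map_add, add_apply, christoffel_spec, g.symm _ (V p) (g.christoffel _ _ _), christoffel_spec]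
  -- In `Γ(u,v;w) + Γ(u,w;v)` all terms cancel except `½ (∂_u g(v,w) + ∂_u g(w,v))`.
  linear_combination (1 / 2 : ℝ) * (g.dcoeff_symm (f p) (mfderiv 𝓘(ℝ, F) 𝓘(ℝ, E) f p X) (V p) (W p))

/-- The Levi-Civita connection along a smooth map is torsion-free. -/
theorem covAlong_mfderiv_sub [CompleteSpace F] [IsManifold 𝓘(ℝ, F) ∞ M]
    {X Y : ∀ q : M, TangentSpace 𝓘(ℝ, F) q} (hf : ContMDiffAt 𝓘(ℝ, F) 𝓘(ℝ, E) ∞ f p)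
    (hX : MDifferentiableAt 𝓘(ℝ, F) 𝓘(ℝ, F).tangent
      (fun q ↦ (⟨q, X q⟩ : TangentBundle 𝓘(ℝ, F) M)) p)
    (hY : MDifferentiableAt 𝓘(ℝ, F) 𝓘(ℝ, F).tangent
      (fun q ↦ (⟨q, Y q⟩ : TangentBundle 𝓘(ℝ, F) M)) p) :
    g.covAlong f (fun q ↦ mfderiv 𝓘(ℝ, F) 𝓘(ℝ, E) f q (Y q)) p (X p) -
      g.covAlong f (fun q ↦ mfderiv 𝓘(ℝ, F) 𝓘(ℝ, E) f q (X q)) p (Y p) =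
      mfderiv 𝓘(ℝ, F) 𝓘(ℝ, E) f p (VectorField.mlieBracket 𝓘(ℝ, F) X Y p) := by
  have hc := hf.continuousAt
  set φ := extChartAt 𝓘(ℝ, E) (f p) with hφ
  set h : M → E := fun q ↦ φ (f q) with hh
  have hsm : ContMDiffAt 𝓘(ℝ, F) 𝓘(ℝ, E) ∞ h p := contMDiffAt_extChartAt.comp p hf
  have hfd : ∀ᶠ q in 𝓝 p, MDifferentiableAt 𝓘(ℝ, F) 𝓘(ℝ, E) f q := by
    have h1 : ContMDiffAt 𝓘(ℝ, F) 𝓘(ℝ, E) 1 f p := hf.of_le (by norm_cast)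
    have : IsManifold 𝓘(ℝ, F) 1 M := .of_le (n := ∞) (by norm_cast)
    have : IsManifold 𝓘(ℝ, E) 1 N := .of_le (n := ∞) (by norm_cast)
    filter_upwards [(contMDiffAt_iff_contMDiffAt_nhds (by simp)).1 h1] with q hq using
      hq.mdifferentiableAt one_ne_zero
  have hchart : ∀ᶠ q in 𝓝 p, ∀ v : TangentSpace 𝓘(ℝ, F) q,
      tangentCoord (f p) (f q) (mfderiv 𝓘(ℝ, F) 𝓘(ℝ, E) f q v) = mvfderiv 𝓘(ℝ, F) h q v := by
    filter_upwards [hfd, hc (chart_source_mem_nhds E (f p))] with q hq hq' v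
    rw [hh, mvfderiv_comp_mfderiv_apply (mdifferentiableAt_extChartAt hq') hq]
    exact tangentCoord_eq_mfderiv hq' _
  have hcd (Y : ∀ q : M, TangentSpace 𝓘(ℝ, F) q) :
      coordDeriv f (fun q ↦ mfderiv 𝓘(ℝ, F) 𝓘(ℝ, E) f q (Y q)) p =
        (show TangentSpace 𝓘(ℝ, F) p →L[ℝ] TangentSpace 𝓘(ℝ, E) (f p) from
          mvfderiv 𝓘(ℝ, F) (fun q ↦ mvfderiv 𝓘(ℝ, F) h q (Y q)) p) := by
    refine Filter.EventuallyEq.mvfderiv_eq ?_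
    filter_upwards [hchart] with q hq using hq _
  -- The Christoffel terms cancel by symmetry. What remains is the commutator of `X` and `Y` on the
  -- chart expression `h` of `f`.
  rw [g.covAlong_apply hc, g.covAlong_apply hc, christoffel_symm, add_sub_add_right_eq_sub, hcd,
    hcd]
  refine (mvfderiv_mlieBracket hsm hX hY).trans ?_
  rw [← hchart.self_of_nhds]
  exact tangentCoord_self _ _

end LorentzMetric
end LeviCivita

/-! ### Linear algebra of the degenerate metric and of null frames. -/

section NullGeometry

variable {E : Type*} [NormedAddCommGroup E] [NormedSpace ℝ E]
  {N : Type*} [TopologicalSpace N] [ChartedSpace E N] [IsManifold 𝓘(ℝ, E) ∞ N]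
  {F : Type*} [NormedAddCommGroup F] [NormedSpace ℝ F]
  {M : Type*} [TopologicalSpace M] [ChartedSpace F M]

namespace LorentzMetric

variable (g : LorentzMetric E N)

/-- A vector orthogonal to a nonzero null vector is proportional to it or spacelike. -/
lemma eq_smul_or_pos {x : N} {n v : TangentSpace 𝓘(ℝ, E) x} (hn : n ≠ 0) (hnn : g.val x n n = 0)
    (hnv : g.val x n v = 0) : (∃ c : ℝ, v = c • n) ∨ 0 < g.val x v v := by
  obtain ⟨t, ht, hpos⟩ := g.lorentzian x
  have htn : g.val x t n ≠ 0 := fun h ↦ (hpos n h hn).ne' hnn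
  -- This `c` makes `v - c • n` orthogonal to the timelike `t`, hence spacelike or zero; its square
  -- equals that of `v`, because `n` is null and orthogonal to `v`.
  set c : ℝ := g.val x t v / g.val x t n with hc
  by_cases hv : v - c • n = 0
  · exact Or.inl ⟨c, sub_eq_zero.1 hv⟩
  · right
    have h1 := hpos (v - c • n) (by
      rw [map_sub, map_smul, smul_eq_mul, hc, div_mul_cancel₀ _ htn, sub_self]) hv
    have h2 : g.val x v n = 0 := by rw [g.symm]; exact hnv
    simpa [hnn, hnv, h2] using h1

lemma contMDiffAt_val {f : M → N} {V W : ∀ q : M, TangentSpace 𝓘(ℝ, E) (f q)} {p : M}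
    (hV : ContMDiffAt 𝓘(ℝ, F) 𝓘(ℝ, E).tangent ∞
      (fun q ↦ (⟨f q, V q⟩ : TangentBundle 𝓘(ℝ, E) N)) p)
    (hW : ContMDiffAt 𝓘(ℝ, F) 𝓘(ℝ, E).tangent ∞
      (fun q ↦ (⟨f q, W q⟩ : TangentBundle 𝓘(ℝ, E) N)) p) :
    ContMDiffAt 𝓘(ℝ, F) 𝓘(ℝ, ℝ) ∞ (fun q ↦ g.val (f q) (V q) (W q)) p := by
  obtain ⟨hf, hV'⟩ := contMDiffAt_totalSpace.1 hV
  obtain ⟨-, hW'⟩ := contMDiffAt_totalSpace.1 hW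
  have hcf : ContMDiffAt 𝓘(ℝ, F) 𝓘(ℝ, E →L[ℝ] E →L[ℝ] ℝ) ∞ (fun q ↦ g.coeff (f p) (f q)) p :=
    (g.contMDiffAt_coeff (f p)).comp p hf
  refine ((hcf.clm_apply hV').clm_apply hW').congr_of_eventuallyEq ?_
  filter_upwards [hf.continuousAt (chart_source_mem_nhds E (f p))] with q hq
  have := g.coeff_tangentCoord hq (V q) (W q)
  rw [tangentCoord_apply hq, tangentCoord_apply hq] at this
  exact this.symm

end LorentzMetric

namespace NullHypersurface

variable [IsManifold 𝓘(ℝ, F) ∞ M] {g : LorentzMetric E N} (H : NullHypersurface F M g)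

lemma push_injective (p : M) : Function.Injective (H.push p) := H.injective_mfderiv p

lemma val_push_of_mem_rad {p : M} {n : TangentSpace 𝓘(ℝ, F) p} (hn : n ∈ radSpace g H.imm p)
    (X : TangentSpace 𝓘(ℝ, F) p) : g.val (H.imm p) (H.push p n) (H.push p X) = 0 := by
  have := LinearMap.congr_fun (LinearMap.mem_ker.1 hn) X
  exact this

/-- This dichotomy yields both positivity on the screen, which meets the radical trivially, and the
fact that the radical is a line, since radical vectors have zero length. -/
lemma eq_smul_or_metric_pos {p : M} {n : TangentSpace 𝓘(ℝ, F) p} (hn : n ∈ radSpace g H.imm p)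
    (hn0 : n ≠ 0) (X : TangentSpace 𝓘(ℝ, F) p) : (∃ c : ℝ, X = c • n) ∨ 0 < H.metric p X X := by
  refine (g.eq_smul_or_pos ((map_ne_zero_iff _ (H.push_injective p)).2 hn0)
    (H.val_push_of_mem_rad hn n) (H.val_push_of_mem_rad hn X)).imp_left ?_
  rintro ⟨c, hc⟩
  exact ⟨c, H.push_injective p (by rw [hc, map_smul])⟩

lemma metric_pos {p : M} {X : TangentSpace 𝓘(ℝ, F) p} (hX : X ∈ H.screen p) (hX0 : X ≠ 0) :
    0 < H.metric p X X := by
  obtain ⟨n, hn, hn0⟩ := (Submodule.ne_bot_iff _).1 (H.degenerate p)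
  refine (H.eq_smul_or_metric_pos hn hn0 X).resolve_left ?_
  rintro ⟨c, rfl⟩
  exact hX0 (Submodule.disjoint_def.1 (H.screen_compl p).disjoint _ hX
    (Submodule.smul_mem _ c hn))

lemma exists_eq_smul_of_mem_rad {p : M} {n X : TangentSpace 𝓘(ℝ, F) p}
    (hn : n ∈ radSpace g H.imm p) (hn0 : n ≠ 0) (hX : X ∈ radSpace g H.imm p) :
    ∃ c : ℝ, X = c • n :=
  (H.eq_smul_or_metric_pos hn hn0 X).resolve_right (H.val_push_of_mem_rad hX X).le.not_gt

lemma metric_symm (p : M) (X Y : TangentSpace 𝓘(ℝ, F) p) : H.metric p X Y = H.metric p Y X :=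
  g.symm _ _ _

section finrank

/-- The tangent spaces of `M` are the orthogonal complements of the radical directions. -/
lemma exists_push_eq [FiniteDimensional ℝ E] {p : M} {n : TangentSpace 𝓘(ℝ, F) p} (hn : n ∈ radSpace g H.imm p)
    (hn0 : n ≠ 0) {v : TangentSpace 𝓘(ℝ, E) (H.imm p)}
    (hv : g.val (H.imm p) (H.push p n) v = 0) : ∃ X, H.push p X = v := by
  set l : Module.Dual ℝ (TangentSpace 𝓘(ℝ, E) (H.imm p)) := g.form (H.imm p) (H.push p n) with hl
  have hl0 : l ≠ 0 := fun h ↦ hn0 ((map_eq_zero_iff _ (H.push_injective p)).1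
    (g.eq_zero_of_forall _ _ fun w ↦ LinearMap.congr_fun h w))
  have hle : LinearMap.range (H.push p).toLinearMap ≤ LinearMap.ker l := by
    rintro _ ⟨X, rfl⟩
    exact H.val_push_of_mem_rad hn X
  have hr : Module.finrank ℝ (LinearMap.range (H.push p).toLinearMap) = Module.finrank ℝ F :=
    LinearMap.finrank_range_of_inj (H.push_injective p)
  have hk := Module.Dual.finrank_ker_add_one_of_ne_zero hl0
  have hE : Module.finrank ℝ (TangentSpace 𝓘(ℝ, E) (H.imm p)) = Module.finrank ℝ F + 1 :=
    H.codim_one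
  -- The tangent space lies in the kernel of `l`, and both have codimension one.
  have heq := Submodule.eq_of_le_of_finrank_eq hle (by omega)
  have : v ∈ LinearMap.range (H.push p).toLinearMap := heq ▸ LinearMap.mem_ker.2 hv
  exact this

variable [FiniteDimensional ℝ F]

lemma finrank_screen_add_one (p : M) :
    Module.finrank ℝ (H.screen p) + 1 = Module.finrank ℝ F := by
  obtain ⟨n, hn, hn0⟩ := (Submodule.ne_bot_iff _).1 (H.degenerate p)
  have h1 : Module.finrank ℝ (radSpace (F := F) g H.imm p) = 1 := by
    refine finrank_eq_one (⟨n, hn⟩ : radSpace (F := F) g H.imm p) (by simpa using hn0) fun w ↦ ?_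
    obtain ⟨c, hc⟩ := H.exists_eq_smul_of_mem_rad hn hn0 w.2
    exact ⟨c, Subtype.ext hc.symm⟩
  rw [← h1]
  exact Submodule.finrank_add_eq_of_isCompl (H.screen_compl p)

lemma metric_star {Z : ∀ p : M, TangentSpace 𝓘(ℝ, E) (H.imm p)} {p : M}
    {X : TangentSpace 𝓘(ℝ, F) p} (hX : X ∈ H.screen p) :
    H.metric p (H.star Z p) X = g.val (H.imm p) (Z p) (H.push p X) :=
  H.screenProj_spec p (Z p) ⟨X, hX⟩

lemma star_mem (Z : ∀ p : M, TangentSpace 𝓘(ℝ, E) (H.imm p)) (p : M) : H.star Z p ∈ H.screen p :=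
  (H.screenProj p (Z p)).2

variable [FiniteDimensional ℝ E]

/-- The norm of a vector along `M` in terms of its components with respect to a null frame. -/
lemma val_self_eq {ξ : ∀ p : M, TangentSpace 𝓘(ℝ, F) p}
    {ν : ∀ p : M, TangentSpace 𝓘(ℝ, E) (H.imm p)} (h : H.IsNullFrame ξ ν)
    (Z : ∀ p : M, TangentSpace 𝓘(ℝ, E) (H.imm p)) (p : M) :
    g.val (H.imm p) (Z p) (Z p) = H.metric p (H.star Z p) (H.star Z p) +
      2 * g.val (H.imm p) (Z p) (H.push p (ξ p)) * g.val (H.imm p) (Z p) (ν p) := by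
  have hξ : ξ p ∈ radSpace g H.imm p := h.smooth_left.2 p (mem_univ p)
  have hξν := h.inner_eq_one p
  have hξ0 : ξ p ≠ 0 := by
    intro h0
    rw [h0, map_zero, map_zero, zero_apply] at hξν
    exact zero_ne_one hξν
  have hS := H.star_mem Z p
  set S := H.star Z p with hSdef
  set a := g.val (H.imm p) (Z p) (ν p) with ha
  set b := g.val (H.imm p) (Z p) (H.push p (ξ p)) with hb
  have hνξ : g.val (H.imm p) (ν p) (H.push p (ξ p)) = 1 := by rw [g.symm]; exact hξν
  have hSξ : g.val (H.imm p) (H.push p S) (H.push p (ξ p)) = 0 := by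
    rw [g.symm]; exact H.val_push_of_mem_rad hξ S
  have hξS := H.val_push_of_mem_rad hξ S
  have hξξ := H.val_push_of_mem_rad hξ (ξ p)
  have hνν := h.inner_self p
  have hνS := h.orthogonal p S hS
  have hSν : g.val (H.imm p) (H.push p S) (ν p) = 0 := by rw [g.symm]; exact hνS
  -- The remainder of `Z` after removing its expected components is shown to vanish: orthogonality
  -- to `ξ` makes it tangent to `M`, pairing with the screen kills its screen part, and pairing with
  -- `ν` its radical part. The coefficient along `ξ` is the pairing with `ν`, and conversely.
  obtain ⟨X, hX⟩ := H.exists_push_eq hξ hξ0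
    (v := Z p - H.push p S - a • H.push p (ξ p) - b • ν p) (by
      rw [g.symm]; simp [hνξ, hSξ, hξξ, ← hb])
  have hXν : g.val (H.imm p) (H.push p X) (ν p) = 0 := by
    rw [hX]; simp [hξν, hSν, hνν, ← ha]
  obtain ⟨X₁, hX₁, X₂, hX₂, rfl⟩ :=
    Submodule.mem_sup.1 ((H.screen_compl p).sup_eq_top.symm ▸ Submodule.mem_top (x := X))
  have hX₁0 : X₁ = 0 := by
    have := H.screenForm_separating p ⟨X₁, hX₁⟩ fun Y ↦ by
      have h1 := congrArg (fun v ↦ g.val (H.imm p) v (H.push p Y)) hX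
      have h2 := H.metric_star (Z := Z) Y.2
      have h3 := H.val_push_of_mem_rad hX₂ Y
      have h4 := h.orthogonal p Y Y.2
      have h5 := H.val_push_of_mem_rad hξ Y
      rw [metric, ← hSdef] at h2
      simp [h2, h3, h4, h5] at h1
      exact h1
    exact congrArg Subtype.val this
  obtain ⟨c, rfl⟩ := H.exists_eq_smul_of_mem_rad hξ hξ0 hX₂
  have hc : c = 0 := by
    simpa [hX₁0, hξν] using hXν
  rw [hX₁0, hc, zero_smul, add_zero, map_zero] at hX
  have hZ : Z p = H.push p S + a • H.push p (ξ p) + b • ν p := by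
    rw [eq_comm, ← sub_eq_zero, ← neg_eq_zero, hX]; abel
  rw [metric, hZ]
  simp [hξν, hνξ, hSξ, hξS, hξξ, hνν, hνS, hSν]
  ring

end finrank
end NullHypersurface
end NullGeometry

/-! ### Smooth sections and local orthonormal frames of the screen. -/

section Frames

variable {E : Type*} [NormedAddCommGroup E] [NormedSpace ℝ E]
  {N : Type*} [TopologicalSpace N] [ChartedSpace E N] [IsManifold 𝓘(ℝ, E) ∞ N]
  {F : Type*} [NormedAddCommGroup F] [NormedSpace ℝ F]
  {M : Type*} [TopologicalSpace M] [ChartedSpace F M]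

lemma ContMDiffOn.inv_sqrt {a : M → ℝ} {U : Set M} (ha : ContMDiffOn 𝓘(ℝ, F) 𝓘(ℝ, ℝ) ∞ a U)
    (hpos : ∀ q ∈ U, 0 < a q) : ContMDiffOn 𝓘(ℝ, F) 𝓘(ℝ, ℝ) ∞ (fun q ↦ (√(a q))⁻¹) U := by
  intro q hq
  have h1 : ContDiffAt ℝ ∞ (fun t : ℝ ↦ (√t)⁻¹) (a q) :=
    (Real.contDiffAt_sqrt (hpos q hq).ne').inv (Real.sqrt_pos.2 (hpos q hq)).ne'
  exact h1.contMDiffAt.comp_contMDiffWithinAt q (ha q hq)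

variable [IsManifold 𝓘(ℝ, F) ∞ M]

section Sections

variable {S : ∀ p : M, Submodule ℝ (TangentSpace 𝓘(ℝ, F) p)} {U U' : Set M}
  {X Y : ∀ p : M, TangentSpace 𝓘(ℝ, F) p}

lemma IsSmoothSectionOn.add (hX : IsSmoothSectionOn S U X) (hY : IsSmoothSectionOn S U Y) :
    IsSmoothSectionOn S U (fun q ↦ X q + Y q) :=
  ⟨hX.1.add_section hY.1, fun q hq ↦ (S q).add_mem (hX.2 q hq) (hY.2 q hq)⟩

lemma IsSmoothSectionOn.smul {a : M → ℝ} (ha : ContMDiffOn 𝓘(ℝ, F) 𝓘(ℝ, ℝ) ∞ a U)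
    (hX : IsSmoothSectionOn S U X) : IsSmoothSectionOn S U (fun q ↦ a q • X q) :=
  ⟨ha.smul_section hX.1, fun q hq ↦ (S q).smul_mem _ (hX.2 q hq)⟩

lemma IsSmoothSectionOn.mono (hX : IsSmoothSectionOn S U X) (h : U' ⊆ U) :
    IsSmoothSectionOn S U' X :=
  ⟨hX.1.mono h, fun q hq ↦ hX.2 q (h hq)⟩

lemma IsSmoothSectionOn.congr (hX : IsSmoothSectionOn S U X) (h : ∀ q ∈ U, Y q = X q) :
    IsSmoothSectionOn S U Y :=
  ⟨hX.1.congr fun q hq ↦ by rw [h q hq], fun q hq ↦ h q hq ▸ hX.2 q hq⟩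

lemma IsSmoothSectionOn.contMDiffAt (hX : IsSmoothSectionOn S U X) (hU : IsOpen U) {p : M}
    (hp : p ∈ U) : ContMDiffAt 𝓘(ℝ, F) 𝓘(ℝ, F).tangent ∞
      (fun q ↦ (⟨q, X q⟩ : TangentBundle 𝓘(ℝ, F) M)) p :=
  hX.1.contMDiffAt (hU.mem_nhds hp)

lemma IsSmoothSectionOn.mdifferentiableAt (hX : IsSmoothSectionOn S U X) (hU : IsOpen U) {p : M}
    (hp : p ∈ U) : MDifferentiableAt 𝓘(ℝ, F) 𝓘(ℝ, F).tangent
      (fun q ↦ (⟨q, X q⟩ : TangentBundle 𝓘(ℝ, F) M)) p :=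
  (hX.contMDiffAt hU hp).mdifferentiableAt (by simp)

end Sections

namespace NullHypersurface

variable {g : LorentzMetric E N} (H : NullHypersurface F M g)
  {U : Set M} {X Y T W : ∀ p : M, TangentSpace 𝓘(ℝ, F) p}

lemma contMDiffAt_push {p : M} (hX : ContMDiffAt 𝓘(ℝ, F) 𝓘(ℝ, F).tangent ∞
      (fun q ↦ (⟨q, X q⟩ : TangentBundle 𝓘(ℝ, F) M)) p) :
    ContMDiffAt 𝓘(ℝ, F) 𝓘(ℝ, E).tangent ∞
      (fun q ↦ (⟨H.imm q, H.push q (X q)⟩ : TangentBundle 𝓘(ℝ, E) N)) p :=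
  (H.contMDiff_imm.contMDiff_tangentMap (m := ∞) (by simp)).contMDiffAt.comp p hX

lemma mdiffAlongAt_push {p : M} (hX : ContMDiffAt 𝓘(ℝ, F) 𝓘(ℝ, F).tangent ∞
      (fun q ↦ (⟨q, X q⟩ : TangentBundle 𝓘(ℝ, F) M)) p) :
    MDiffAlongAt (F := F) H.imm (fun q ↦ H.push q (X q)) p :=
  (H.contMDiffAt_push hX).mdifferentiableAt (by simp)

lemma contMDiffOn_metric (hU : IsOpen U) (hX : IsSmoothSectionOn H.screen U X)
    (hY : IsSmoothSectionOn H.screen U Y) :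
    ContMDiffOn 𝓘(ℝ, F) 𝓘(ℝ, ℝ) ∞ (fun q ↦ H.metric q (X q) (Y q)) U := fun _ hq ↦
  (g.contMDiffAt_val (H.contMDiffAt_push (hX.contMDiffAt hU hq))
    (H.contMDiffAt_push (hY.contMDiffAt hU hq))).contMDiffWithinAt

lemma metric_add_left (p : M) (u v w : TangentSpace 𝓘(ℝ, F) p) :
    H.metric p (u + v) w = H.metric p u w + H.metric p v w := by
  simp [metric]

lemma metric_smul_left (p : M) (c : ℝ) (u w : TangentSpace 𝓘(ℝ, F) p) :
    H.metric p (c • u) w = c * H.metric p u w := by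
  simp [metric]

lemma metric_add_right (p : M) (u v w : TangentSpace 𝓘(ℝ, F) p) :
    H.metric p w (u + v) = H.metric p w u + H.metric p w v := by
  simp [metric]

lemma metric_smul_right (p : M) (c : ℝ) (u w : TangentSpace 𝓘(ℝ, F) p) :
    H.metric p w (c • u) = c * H.metric p w u := by
  simp [metric]

lemma metric_smul_self_inv_sqrt {p : M} {u : TangentSpace 𝓘(ℝ, F) p} (hu : 0 < H.metric p u u) :
    H.metric p ((√(H.metric p u u))⁻¹ • u) ((√(H.metric p u u))⁻¹ • u) = 1 := by
  rw [metric_smul_left, metric_smul_right]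
  have h := Real.mul_self_sqrt hu.le
  have h0 := (Real.sqrt_pos.2 hu).ne'
  field_simp
  rw [sq, h]

lemma isSmoothSectionOn_normalize (hU : IsOpen U) (hX : IsSmoothSectionOn H.screen U X)
    (hX0 : ∀ q ∈ U, X q ≠ 0) :
    IsSmoothSectionOn H.screen U (fun q ↦ (√(H.metric q (X q) (X q)))⁻¹ • X q) :=
  hX.smul ((H.contMDiffOn_metric hU hX hX).inv_sqrt fun q hq ↦ H.metric_pos (hX.2 q hq) (hX0 q hq))

variable {H} in
lemma IsOrthonormalScreenFrameOn.mono {U' : Set M} (h : H.IsOrthonormalScreenFrameOn U T W)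
    (hU : U' ⊆ U) : H.IsOrthonormalScreenFrameOn U' T W :=
  ⟨h.1.mono hU, h.2.1.mono hU, fun q hq ↦ h.2.2 q (hU hq)⟩

variable [FiniteDimensional ℝ F]

/-- The screen of a null hypersurface of dimension three has local orthonormal frames. -/
lemma exists_orthonormalScreenFrame (hF : Module.finrank ℝ F = 3) (p : M) :
    ∃ (U : Set M) (T W : ∀ p : M, TangentSpace 𝓘(ℝ, F) p),
      IsOpen U ∧ p ∈ U ∧ H.IsOrthonormalScreenFrameOn U T W := by
  obtain ⟨U, hU, hp, k, e, he, hspan⟩ := H.screen_smooth p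
  have hk : k = 2 := by
    have h1 := H.finrank_screen_add_one p
    rw [← (hspan p hp).2, finrank_span_eq_card (hspan p hp).1, Fintype.card_fin] at h1
    omega
  subst hk
  have he0 : ∀ q ∈ U, e 0 q ≠ 0 := fun q hq ↦ (hspan q hq).1.ne_zero 0
  set T : ∀ p : M, TangentSpace 𝓘(ℝ, F) p := fun q ↦ (√(H.metric q (e 0 q) (e 0 q)))⁻¹ • e 0 q
    with hT
  have hTs : IsSmoothSectionOn H.screen U T := H.isSmoothSectionOn_normalize hU (he 0) he0
  have hT1 : ∀ q ∈ U, H.metric q (T q) (T q) = 1 := fun q hq ↦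
    H.metric_smul_self_inv_sqrt (H.metric_pos ((he 0).2 q hq) (he0 q hq))
  -- Gram–Schmidt, carried out pointwise with smooth coefficients.
  set V : ∀ p : M, TangentSpace 𝓘(ℝ, F) p := fun q ↦ e 1 q + (-H.metric q (e 1 q) (T q)) • T q
    with hV
  have hVs : IsSmoothSectionOn H.screen U V :=
    (he 1).add (hTs.smul (H.contMDiffOn_metric hU (he 1) hTs).neg)
  have hV0 : ∀ q ∈ U, V q ≠ 0 := by
    intro q hq h0
    -- `T` is a multiple of `e 0`, so `V q = 0` would be a linear relation between `e 0` and `e 1`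
    -- with coefficient `1` on `e 1`.
    have h1 := LinearIndependent.pair_iff.1
      ((LinearIndependent.pair_iff' (he0 q hq)).2 fun c hc ↦ ?_)
      (-H.metric q (e 1 q) (T q) * (√(H.metric q (e 0 q) (e 0 q)))⁻¹) 1 (by
        rw [mul_smul, one_smul, add_comm]; exact h0)
    · exact one_ne_zero h1.2
    · have h2 := (hspan q hq).1
      have h3 := Fintype.linearIndependent_iff.1 h2 ![c, -1] (by simp [hc]) 1
      simp at h3
  have hVT : ∀ q ∈ U, H.metric q (V q) (T q) = 0 := fun q hq ↦ by
    rw [hV, metric_add_left, metric_smul_left, hT1 q hq]; ring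
  refine ⟨U, T, fun q ↦ (√(H.metric q (V q) (V q)))⁻¹ • V q, hU, hp, hTs,
    H.isSmoothSectionOn_normalize hU hVs hV0, fun q hq ↦ ⟨hT1 q hq,
      H.metric_smul_self_inv_sqrt (H.metric_pos (hVs.2 q hq) (hV0 q hq)), ?_⟩⟩
  rw [metric_smul_right, H.metric_symm q (T q), hVT q hq, mul_zero]

variable {H} in
/-- A pair of orthonormal vectors is a basis of the two-dimensional screen. -/
lemma exists_screenBasis (hF : Module.finrank ℝ F = 3) {p : M} {t w : TangentSpace 𝓘(ℝ, F) p}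
    (ht : t ∈ H.screen p) (hw : w ∈ H.screen p) (htt : H.metric p t t = 1)
    (hww : H.metric p w w = 1) (htw : H.metric p t w = 0) :
    ∃ b : Module.Basis (Fin 2) ℝ (H.screen p), b 0 = ⟨t, ht⟩ ∧ b 1 = ⟨w, hw⟩ ∧
      ∀ x : H.screen p, b.repr x 0 = H.metric p x t ∧ b.repr x 1 = H.metric p x w := by
  have hli : LinearIndependent ℝ ![(⟨t, ht⟩ : H.screen p), ⟨w, hw⟩] := by
    refine LinearIndependent.pair_iff.2 fun a c h ↦ ?_
    have h0 : a • t + c • w = 0 := congrArg Subtype.val h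
    have h1 : H.metric p (a • t + c • w) t = 0 := by rw [h0]; simp [metric]
    have h2 : H.metric p (a • t + c • w) w = 0 := by rw [h0]; simp [metric]
    rw [metric_add_left, metric_smul_left, metric_smul_left] at h1 h2
    rw [H.metric_symm p w t, htt, htw] at h1
    rw [hww, htw] at h2
    constructor <;> linarith
  have hcard : Fintype.card (Fin 2) = Module.finrank ℝ (H.screen p) := by
    have := H.finrank_screen_add_one p
    simp; omega
  refine ⟨basisOfLinearIndependentOfCardEqFinrank hli hcard, by simp, by simp, fun x ↦ ?_⟩
  set b := basisOfLinearIndependentOfCardEqFinrank hli hcard with hb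
  have hx : (x : TangentSpace 𝓘(ℝ, F) p) = b.repr x 0 • t + b.repr x 1 • w := by
    have := congrArg Subtype.val (b.sum_repr x)
    simpa [hb, Fin.sum_univ_two] using this.symm
  rw [hx]
  simp only [metric_add_left, metric_smul_left, htt, hww, htw, H.metric_symm p w t]
  simp

variable {H} in
lemma eq_of_orthonormal (hF : Module.finrank ℝ F = 3) {p : M} {t w x : TangentSpace 𝓘(ℝ, F) p}
    (ht : t ∈ H.screen p) (hw : w ∈ H.screen p) (htt : H.metric p t t = 1)
    (hww : H.metric p w w = 1) (htw : H.metric p t w = 0) (hx : x ∈ H.screen p) :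
    x = H.metric p x t • t + H.metric p x w • w := by
  obtain ⟨b, h0, h1, h⟩ := exists_screenBasis hF ht hw htt hww htw
  have hsum := b.sum_repr ⟨x, hx⟩
  rw [Fin.sum_univ_two, h0, h1, (h _).1, (h _).2] at hsum
  exact (congrArg Subtype.val hsum).symm

variable {H} in
lemma trace_eq_of_orthonormal (hF : Module.finrank ℝ F = 3) {p : M}
    {t w : TangentSpace 𝓘(ℝ, F) p}
    (ht : t ∈ H.screen p) (hw : w ∈ H.screen p) (htt : H.metric p t t = 1)
    (hww : H.metric p w w = 1) (htw : H.metric p t w = 0) (A : H.screen p →ₗ[ℝ] H.screen p) :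
    LinearMap.trace ℝ (H.screen p) A =
      H.metric p (A ⟨t, ht⟩) t + H.metric p (A ⟨w, hw⟩) w := by
  obtain ⟨b, h0, h1, h⟩ := exists_screenBasis hF ht hw htt hww htw
  rw [LinearMap.trace_eq_matrix_trace ℝ b, Matrix.trace, Fin.sum_univ_two, Matrix.diag,
    Matrix.diag, LinearMap.toMatrix_apply, LinearMap.toMatrix_apply, (h _).1, (h _).2, h0, h1]

end NullHypersurface
end Frames

/-! ### The screen connection, the parallel field, and flatness. -/

section ParallelField

variable {E : Type*} [NormedAddCommGroup E] [NormedSpace ℝ E]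
  {N : Type*} [TopologicalSpace N] [ChartedSpace E N] [IsManifold 𝓘(ℝ, E) ∞ N]
  {F : Type*} [NormedAddCommGroup F] [NormedSpace ℝ F]
  {M : Type*} [TopologicalSpace M] [ChartedSpace F M]

lemma mvfderiv_real_comp {φ : ℝ → ℝ} {φ' : ℝ} {a : M → ℝ} {p : M}
    (hφ : HasDerivAt φ φ' (a p)) (ha : MDifferentiableAt 𝓘(ℝ, F) 𝓘(ℝ, ℝ) a p)
    (X : TangentSpace 𝓘(ℝ, F) p) :
    mvfderiv 𝓘(ℝ, F) (fun q ↦ φ (a q)) p X = mvfderiv 𝓘(ℝ, F) a p X * φ' := by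
  rw [mvfderiv_fderiv_comp_apply hφ.differentiableAt ha, hφ.hasFDerivAt.fderiv]
  simp

variable [IsManifold 𝓘(ℝ, F) ∞ M]

namespace NullHypersurface

variable {g : LorentzMetric E N} {H : NullHypersurface F M g}
  {Z : ∀ p : M, TangentSpace 𝓘(ℝ, E) (H.imm p)}
  {U : Set M} {X Y V V' T W : ∀ p : M, TangentSpace 𝓘(ℝ, F) p} {p : M}

lemma IsSmoothAlong.mdiffAlongAt (hZ : H.IsSmoothAlong Z) (p : M) :
    MDiffAlongAt (F := F) H.imm Z p :=
  (hZ p).mdifferentiableAt (by simp)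

lemma _root_.IsSmoothSectionOn.mdiffAlongAt_push {S : ∀ p : M, Submodule ℝ (TangentSpace 𝓘(ℝ, F) p)}
    (hX : IsSmoothSectionOn S U X) (hU : IsOpen U) (hp : p ∈ U) :
    MDiffAlongAt (F := F) H.imm (fun q ↦ H.push q (X q)) p :=
  H.mdiffAlongAt_push (hX.contMDiffAt hU hp)

variable [FiniteDimensional ℝ F]

/-- The screen component of a smooth vector field is smooth. -/
lemma isSmoothSectionOn_star (hF : Module.finrank ℝ F = 3) (hZ : H.IsSmoothAlong Z) :
    IsSmoothSectionOn H.screen univ (H.star Z) := by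
  refine ⟨fun p _ ↦ ?_, fun p _ ↦ H.star_mem Z p⟩
  obtain ⟨U, T, W, hU, hp, hT, hW, hTW⟩ := H.exists_orthonormalScreenFrame hF p
  have hc {T : ∀ p : M, TangentSpace 𝓘(ℝ, F) p} (hT : IsSmoothSectionOn H.screen U T) :
      ContMDiffOn 𝓘(ℝ, F) 𝓘(ℝ, ℝ) ∞ (fun q ↦ g.val (H.imm q) (Z q) (H.push q (T q))) U :=
    fun q hq ↦ (g.contMDiffAt_val (hZ q)
      (H.contMDiffAt_push (hT.contMDiffAt hU hq))).contMDiffWithinAt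
  -- The projection is defined pointwise; smoothness comes from the formula `Z^* = ḡ(Z,T) T + ḡ(Z,W)
  -- W` in a local orthonormal frame.
  have hs := ((hT.smul (hc hT)).add (hW.smul (hc hW))).congr (Y := H.star Z) fun q hq ↦ by
    have := eq_of_orthonormal hF (hT.2 q hq) (hW.2 q hq) (hTW q hq).1 (hTW q hq).2.1
      (hTW q hq).2.2 (H.star_mem Z q)
    rwa [H.metric_star (hT.2 q hq), H.metric_star (hW.2 q hq)] at this
  exact (hs.contMDiffAt hU hp).contMDiffWithinAt

lemma screenProj_push {X : TangentSpace 𝓘(ℝ, F) p} (hX : X ∈ H.screen p) :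
    (H.screenProj p (H.push p X) : TangentSpace 𝓘(ℝ, F) p) = X := by
  have h := H.screenForm_separating p (H.screenProj p (H.push p X) - ⟨X, hX⟩) fun Y ↦ by
    rw [LinearMap.map_sub, LinearMap.sub_apply, sub_eq_zero]
    exact H.screenProj_spec p (H.push p X) Y
  exact congrArg Subtype.val (sub_eq_zero.1 h)

lemma mdiffAlongAt_perp (hF : Module.finrank ℝ F = 3) (hZ : H.IsSmoothAlong Z) (p : M) :
    MDiffAlongAt (F := F) H.imm (H.perp Z) p :=
  (hZ.mdiffAlongAt p).sub
    ((isSmoothSectionOn_star hF hZ).mdiffAlongAt_push isOpen_univ (mem_univ p))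

lemma val_perp_push {Z : ∀ p : M, TangentSpace 𝓘(ℝ, E) (H.imm p)} {Y : TangentSpace 𝓘(ℝ, F) p}
    (hY : Y ∈ H.screen p) : g.val (H.imm p) (H.perp Z p) (H.push p Y) = 0 := by
  have := H.metric_star (Z := Z) hY
  rw [metric] at this
  rw [perp, map_sub, sub_apply, this, sub_self]

lemma isSmoothSectionOn_unitStar (hF : Module.finrank ℝ F = 3) (hZ : H.IsSmoothAlong Z)
    (hstar : ∀ p : M, H.star Z p ≠ 0) : IsSmoothSectionOn H.screen univ (H.unitStar Z) :=
  H.isSmoothSectionOn_normalize isOpen_univ (isSmoothSectionOn_star hF hZ) fun q _ ↦ hstar q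

lemma metric_unitStar (hstar : ∀ p : M, H.star Z p ≠ 0) (p : M) :
    H.metric p (H.unitStar Z p) (H.unitStar Z p) = 1 :=
  H.metric_smul_self_inv_sqrt (H.metric_pos (H.star_mem Z p) (hstar p))

/-- A unit section of the screen is locally part of an orthonormal frame. -/
lemma exists_orthonormalScreenFrame_extending (hF : Module.finrank ℝ F = 3)
    (hT : IsSmoothSectionOn H.screen univ T) (hTT : ∀ q, H.metric q (T q) (T q) = 1) (p : M) :
    ∃ (U : Set M) (W : ∀ p : M, TangentSpace 𝓘(ℝ, F) p),
      IsOpen U ∧ p ∈ U ∧ H.IsOrthonormalScreenFrameOn U T W := by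
  obtain ⟨U, T₀, W₀, hU, hp, hT₀, hW₀, hfr⟩ := H.exists_orthonormalScreenFrame hF p
  have hT' := hT.mono (subset_univ U)
  -- `W` is `T` turned by a right angle, in components with respect to `T₀`, `W₀`.
  refine ⟨U, fun q ↦ (-H.metric q (T q) (W₀ q)) • T₀ q + H.metric q (T q) (T₀ q) • W₀ q, hU, hp,
    hT', (hT₀.smul (H.contMDiffOn_metric hU hT' hW₀).neg).add
      (hW₀.smul (H.contMDiffOn_metric hU hT' hT₀)), fun q hq ↦ ?_⟩
  obtain ⟨h1, h2, h3⟩ := hfr q hq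
  have hexp := eq_of_orthonormal hF (hT₀.2 q hq) (hW₀.2 q hq) h1 h2 h3 (hT'.2 q hq)
  have h4 := hTT q
  have h5 := H.metric_symm q (W₀ q) (T₀ q)
  have h6 : H.metric q (T q) (T q) = H.metric q (T q) (T₀ q) * H.metric q (T q) (T₀ q) +
      H.metric q (T q) (W₀ q) * H.metric q (T q) (W₀ q) := by
    conv_lhs => arg 4; rw [hexp]
    rw [metric_add_right, metric_smul_right, metric_smul_right]
  refine ⟨h4, ?_, ?_⟩
  · simp only [metric_add_left, metric_add_right, metric_smul_left, metric_smul_right, h1, h2, h3, h5]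
    linear_combination h4 - h6
  · simp only [metric_add_right, metric_smul_right]
    ring

variable [FiniteDimensional ℝ E]

lemma screenConn_mem (V : ∀ p : M, TangentSpace 𝓘(ℝ, F) p) (p : M) (X : TangentSpace 𝓘(ℝ, F) p) :
    H.screenConn V p X ∈ H.screen p :=
  (H.screenProj p _).2

lemma metric_screenConn (V : ∀ p : M, TangentSpace 𝓘(ℝ, F) p) (p : M)
    (X : TangentSpace 𝓘(ℝ, F) p) {Y : TangentSpace 𝓘(ℝ, F) p} (hY : Y ∈ H.screen p) :
    H.metric p (H.screenConn V p X) Y =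
      g.val (H.imm p) (g.covAlong H.imm (fun q ↦ H.push q (V q)) p X) (H.push p Y) :=
  H.screenProj_spec p _ ⟨Y, hY⟩

lemma screenConn_congr (h : V =ᶠ[𝓝 p] V') : H.screenConn V p = H.screenConn V' p := by
  have : (fun q ↦ H.push q (V q)) =ᶠ[𝓝 p] fun q ↦ H.push q (V' q) := by
    filter_upwards [h] with q hq
    rw [hq]
  rw [screenConn, screenConn, g.covAlong_congr this]

lemma screenConn_add
    (hV : MDiffAlongAt (F := F) H.imm (fun q ↦ H.push q (V q)) p)
    (hV' : MDiffAlongAt (F := F) H.imm (fun q ↦ H.push q (V' q)) p)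
    (X : TangentSpace 𝓘(ℝ, F) p) :
    H.screenConn (fun q ↦ V q + V' q) p X = H.screenConn V p X + H.screenConn V' p X := by
  have h := g.covAlong_add hV hV' X
  simp only [screenConn, LinearMap.comp_apply, map_add, h]

/-- The Leibniz term is the projection of `V p`, which is `V p` itself only when this vector lies in
the screen. -/
lemma screenConn_smul {a : M → ℝ} (ha : MDifferentiableAt 𝓘(ℝ, F) 𝓘(ℝ, ℝ) a p)
    (hV : MDiffAlongAt (F := F) H.imm (fun q ↦ H.push q (V q)) p) (hVp : V p ∈ H.screen p)
    (X : TangentSpace 𝓘(ℝ, F) p) :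
    H.screenConn (fun q ↦ a q • V q) p X =
      mvfderiv 𝓘(ℝ, F) a p X • V p + a p • H.screenConn V p X := by
  have h := g.covAlong_smul ha hV X
  simp only [screenConn, LinearMap.comp_apply, map_smul, h, map_add, Submodule.subtype_apply]
  rw [screenProj_push hVp]

/-- The screen connection is metric. -/
lemma mvfderiv_metric (hU : IsOpen U) (hp : p ∈ U) (hV : IsSmoothSectionOn H.screen U V)
    (hV' : IsSmoothSectionOn H.screen U V') (X : TangentSpace 𝓘(ℝ, F) p) :
    mvfderiv 𝓘(ℝ, F) (fun q ↦ H.metric q (V q) (V' q)) p X =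
      H.metric p (H.screenConn V p X) (V' p) + H.metric p (V p) (H.screenConn V' p X) := by
  rw [metric_screenConn _ _ _ (hV'.2 p hp), H.metric_symm p (V p),
    metric_screenConn _ _ _ (hV.2 p hp), g.symm _ _ (H.push p (V p))]
  exact g.mvfderiv_val (hV.mdiffAlongAt_push hU hp) (hV'.mdiffAlongAt_push hU hp) X

/-- The squared length of the screen component of a parallel vector field of constant angle is
locally constant. -/
lemma mvfderiv_metric_star_eq_zero (hZ : H.IsSmoothAlong Z) (hpar : H.IsParallelAlong Z)
    (hangle : H.HasConstantAngle Z) (p : M) (X : TangentSpace 𝓘(ℝ, F) p) :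
    mvfderiv 𝓘(ℝ, F) (fun q ↦ H.metric q (H.star Z q) (H.star Z q)) p X = 0 := by
  obtain ⟨hnn, ξ, ν, hfr, ⟨a, ha⟩, b, hb⟩ := hangle
  set h : M → ℝ := fun q ↦ g.val (H.imm q) (Z q) (Z q) with hh
  have hd : MDifferentiableAt 𝓘(ℝ, F) 𝓘(ℝ, ℝ) h p :=
    (g.contMDiffAt_val (hZ p) (hZ p)).mdifferentiableAt (by simp)
  have hdh : mvfderiv 𝓘(ℝ, F) h p X = 0 := by
    rw [g.mvfderiv_val (hZ.mdiffAlongAt p) (hZ.mdiffAlongAt p), hpar p X]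
    simp
  -- Substituting the constant angles in `val_self_eq` gives `|Z^*|² = h - 2ab|h|` with `h =
  -- ḡ(Z,Z)`. The absolute value covers both causal characters of `Z` and is differentiable because
  -- `h` never vanishes.
  have hm : (fun q ↦ H.metric q (H.star Z q) (H.star Z q)) =
      fun q ↦ (fun t : ℝ ↦ t - 2 * a * b * |t|) (h q) := by
    ext q
    have h1 := H.val_self_eq hfr Z q
    have hl : 0 < H.length Z q := Real.sqrt_pos.2 (abs_pos.2 (hnn q))
    have hl2 : H.length Z q * H.length Z q = |h q| := Real.mul_self_sqrt (abs_nonneg _)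
    have h2 := (div_eq_iff hl.ne').1 (ha q)
    have h3 := (div_eq_iff hl.ne').1 (hb q)
    rw [h2, h3] at h1
    change _ = h q - _
    rw [← hl2, hh]
    linear_combination -h1
  have hφ : HasDerivAt (fun t : ℝ ↦ t - 2 * a * b * |t|)
      (1 - 2 * a * b * (SignType.sign (h p) : ℝ)) (h p) :=
    (hasDerivAt_id _).sub ((hasDerivAt_abs (hnn p)).const_mul (2 * a * b))
  rw [hm, mvfderiv_real_comp hφ hd, hdh, zero_mul]

lemma covAlong_perp (hF : Module.finrank ℝ F = 3) (hZ : H.IsSmoothAlong Z)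
    (hpar : H.IsParallelAlong Z) (p : M) (X : TangentSpace 𝓘(ℝ, F) p) :
    g.covAlong H.imm (H.perp Z) p X =
      -g.covAlong H.imm (fun q ↦ H.push q (H.star Z q)) p X := by
  have h := g.covAlong_sub (hZ.mdiffAlongAt p)
    ((isSmoothSectionOn_star hF hZ).mdiffAlongAt_push isOpen_univ (mem_univ p)) X
  rw [hpar p X, zero_sub] at h
  exact h

/-- For a parallel vector field `Z`, the shape operator of `Z^⊥` is the screen derivative of
`Z^*`. -/
lemma shapeOp_perp (hF : Module.finrank ℝ F = 3) (hZ : H.IsSmoothAlong Z)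
    (hpar : H.IsParallelAlong Z) (p : M) (X : H.screen p) :
    (H.shapeOp (H.perp Z) p X : TangentSpace 𝓘(ℝ, F) p) = H.screenConn (H.star Z) p X := by
  simp only [shapeOp, LinearMap.neg_apply, LinearMap.comp_apply, Submodule.subtype_apply,
    covAlong_perp hF hZ hpar, map_neg, neg_neg]
  rfl

/-- On an integrable screen, the screen derivative of `Z^*` is self-adjoint if `Z` is parallel. -/
lemma metric_screenConn_star_comm (hF : Module.finrank ℝ F = 3)
    (hint : IsIntegrableDistribution H.screen) (hZ : H.IsSmoothAlong Z)
    (hpar : H.IsParallelAlong Z) (hU : IsOpen U) (hp : p ∈ U)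
    (hX : IsSmoothSectionOn H.screen U X) (hY : IsSmoothSectionOn H.screen U Y) :
    H.metric p (H.screenConn (H.star Z) p (X p)) (Y p) =
      H.metric p (H.screenConn (H.star Z) p (Y p)) (X p) := by
  -- Differentiate `ḡ(Z^⊥, Y) = 0` and replace `∇̄_X Z^⊥` by `-∇̄_X Z^*`.
  have key {X Y : ∀ p : M, TangentSpace 𝓘(ℝ, F) p} (hY : IsSmoothSectionOn H.screen U Y) :
      H.metric p (H.screenConn (H.star Z) p (X p)) (Y p) = g.val (H.imm p) (H.perp Z p)
        (g.covAlong H.imm (fun q ↦ H.push q (Y q)) p (X p)) := by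
    have h1 := g.mvfderiv_val (mdiffAlongAt_perp hF hZ p) (hY.mdiffAlongAt_push hU hp) (X p)
    have h0 : (fun q ↦ g.val (H.imm q) (H.perp Z q) (H.push q (Y q))) =ᶠ[𝓝 p] fun _ ↦ (0 : ℝ) := by
      filter_upwards [hU.mem_nhds hp] with q hq using val_perp_push (hY.2 q hq)
    rw [h0.mvfderiv_eq, mvfderiv_const, covAlong_perp hF hZ hpar, map_neg, neg_apply] at h1
    rw [metric_screenConn _ _ _ (hY.2 p hp)]
    have h2 : (0 : TangentSpace 𝓘(ℝ, F) p →L[ℝ] ℝ) (X p) = 0 := rfl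
    rw [h2] at h1
    linarith
  have : CompleteSpace F := FiniteDimensional.complete ℝ F
  -- The difference of the two sides is `ḡ(Z^⊥, [X,Y])`, which vanishes because the bracket stays in
  -- the screen.
  rw [key hY, key hX, ← sub_eq_zero, ← map_sub]
  have h3 := g.covAlong_mfderiv_sub (H.contMDiff_imm p) (hX.mdifferentiableAt hU hp)
    (hY.mdifferentiableAt hU hp)
  refine (congrArg (g.val (H.imm p) (H.perp Z p)) h3).trans ?_
  exact val_perp_push (hint U hU X Y hX hY p hp)

/-- The normalizing factor has zero derivative, since `|Z^*|²` does, so the Leibniz term disappears.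
-/
lemma screenConn_unitStar (hF : Module.finrank ℝ F = 3) (hZ : H.IsSmoothAlong Z)
    (hpar : H.IsParallelAlong Z) (hangle : H.HasConstantAngle Z)
    (hstar : ∀ p : M, H.star Z p ≠ 0) (p : M) (X : TangentSpace 𝓘(ℝ, F) p) :
    H.screenConn (H.unitStar Z) p X =
      (√(H.metric p (H.star Z p) (H.star Z p)))⁻¹ • H.screenConn (H.star Z) p X := by
  have hs := isSmoothSectionOn_star hF hZ
  have hm := H.contMDiffOn_metric isOpen_univ hs hs
  have hpos := H.metric_pos (H.star_mem Z p) (hstar p)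
  have hφ : HasDerivAt (fun t : ℝ ↦ (√t)⁻¹) _ (H.metric p (H.star Z p) (H.star Z p)) :=
    (Real.hasDerivAt_sqrt hpos.ne').inv (Real.sqrt_pos.2 hpos).ne'
  have h1 : mvfderiv 𝓘(ℝ, F) (fun q ↦ (√(H.metric q (H.star Z q) (H.star Z q)))⁻¹) p X = 0 := by
    rw [mvfderiv_real_comp (a := fun q ↦ H.metric q (H.star Z q) (H.star Z q)) hφ
      ((hm.contMDiffAt Filter.univ_mem).mdifferentiableAt (x := p) (by simp)),
      mvfderiv_metric_star_eq_zero hZ hpar hangle, zero_mul]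
  have h2 := hm.inv_sqrt fun q _ ↦ H.metric_pos (H.star_mem Z q) (hstar q)
  have h3 := screenConn_smul ((h2.contMDiffAt Filter.univ_mem).mdifferentiableAt (x := p) (by simp))
    (hs.mdiffAlongAt_push isOpen_univ (mem_univ p)) (H.star_mem Z p) X
  rw [h1, zero_smul, zero_add] at h3
  exact h3

/-- A local orthonormal screen frame extending the direction of a parallel field of constant angle
is parallel along the screen, if the trace of the shape operator vanishes. -/
theorem screenConn_frame_eq_zero (hF : Module.finrank ℝ F = 3)
    (hint : IsIntegrableDistribution H.screen) (hZ : H.IsSmoothAlong Z)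
    (hpar : H.IsParallelAlong Z) (hangle : H.HasConstantAngle Z)
    (hstar : ∀ p : M, H.star Z p ≠ 0)
    (htr : ∀ p : M, LinearMap.trace ℝ (H.screen p) (H.shapeOp (H.perp Z) p) = 0)
    (hU : IsOpen U) (hTW : H.IsOrthonormalScreenFrameOn U (H.unitStar Z) W) (hp : p ∈ U)
    {X : TangentSpace 𝓘(ℝ, F) p} (hX : X ∈ H.screen p) :
    H.screenConn (H.unitStar Z) p X = 0 ∧ H.screenConn W p X = 0 := by
  obtain ⟨hT, hW, hfr⟩ := hTW
  set T := H.unitStar Z with hTdef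
  obtain ⟨hTT, hWW, hTWp⟩ := hfr p hp
  have hTp := hT.2 p hp
  have hWp := hW.2 p hp
  have hconst {V V' : ∀ p : M, TangentSpace 𝓘(ℝ, F) p} (hV : IsSmoothSectionOn H.screen U V)
      (hV' : IsSmoothSectionOn H.screen U V') {c : ℝ} (hc : ∀ q ∈ U, H.metric q (V q) (V' q) = c)
      (X : TangentSpace 𝓘(ℝ, F) p) :
      H.metric p (H.screenConn V p X) (V' p) + H.metric p (V p) (H.screenConn V' p X) = 0 := by
    have h0 : (fun q ↦ H.metric q (V q) (V' q)) =ᶠ[𝓝 p] fun _ ↦ c := by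
      filter_upwards [hU.mem_nhds hp] with q hq using hc q hq
    rw [← mvfderiv_metric hU hp hV hV', h0.mvfderiv_eq, mvfderiv_const]
    rfl
  have hTT0 (X : TangentSpace 𝓘(ℝ, F) p) : H.metric p (H.screenConn T p X) (T p) = 0 := by
    have := hconst hT hT (fun q hq ↦ (hfr q hq).1) X
    rw [H.metric_symm p (T p)] at this
    linarith
  have hWW0 (X : TangentSpace 𝓘(ℝ, F) p) : H.metric p (H.screenConn W p X) (W p) = 0 := by
    have := hconst hW hW (fun q hq ↦ (hfr q hq).2.1) X
    rw [H.metric_symm p (W p)] at this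
    linarith
  have hTW0 (X : TangentSpace 𝓘(ℝ, F) p) :
      H.metric p (H.screenConn W p X) (T p) = -H.metric p (H.screenConn T p X) (W p) := by
    have := hconst hT hW (fun q hq ↦ (hfr q hq).2.2) X
    rw [H.metric_symm p (T p)] at this
    linarith
  have hconn := screenConn_unitStar hF hZ hpar hangle hstar p
  have htrace := htr p
  rw [trace_eq_of_orthonormal hF hTp hWp hTT hWW hTWp, shapeOp_perp hF hZ hpar,
    shapeOp_perp hF hZ hpar] at htrace
  have hsymm := metric_screenConn_star_comm hF hint hZ hpar hU hp hT hW
  set c := (√(H.metric p (H.star Z p) (H.star Z p)))⁻¹ with hc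
  -- Self-adjointness exchanges this for the `T`-component of `∇^*_W T`, which is zero because `T`
  -- has unit length.
  have hTW' : H.metric p (H.screenConn T p (T p)) (W p) = 0 := by
    rw [hconn, metric_smul_left, hsymm, ← metric_smul_left, ← hconn]
    exact hTT0 _
  -- The `T`-`T` diagonal entry of the shape operator is zero, so the trace condition leaves nothing
  -- for the `W`-`W` entry.
  have hWW' : H.metric p (H.screenConn T p (W p)) (W p) = 0 := by
    have h1 := hTT0 (T p)
    rw [hconn, metric_smul_left] at h1 ⊢
    linear_combination c * htrace - h1
  have hTX : H.metric p (H.screenConn T p X) (W p) = 0 := by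
    rw [eq_of_orthonormal hF hTp hWp hTT hWW hTWp hX]
    simp only [map_add, map_smul, metric_add_left, metric_smul_left, hTW', hWW']
    ring
  constructor
  · rw [eq_of_orthonormal hF hTp hWp hTT hWW hTWp (screenConn_mem T p X), hTT0, hTX]
    simp
  · rw [eq_of_orthonormal hF hTp hWp hTT hWW hTWp (screenConn_mem W p X), hTW0, hWW0, hTX]
    simp

/-- A screen with local parallel orthonormal frames is flat. -/
theorem isScreenFlat_of_parallel_frame (hF : Module.finrank ℝ F = 3)
    (hint : IsIntegrableDistribution H.screen)
    (hframe : ∀ p : M, ∃ (U : Set M) (T W : ∀ p : M, TangentSpace 𝓘(ℝ, F) p),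
      IsOpen U ∧ p ∈ U ∧ H.IsOrthonormalScreenFrameOn U T W ∧
        ∀ q ∈ U, ∀ X ∈ H.screen q, H.screenConn T q X = 0 ∧ H.screenConn W q X = 0) :
    H.IsScreenFlat := by
  intro U₁ hU₁ X Y V hX hY hV p hp₁
  obtain ⟨U₂, T, W, hU₂, hp₂, hTW, hpar⟩ := hframe p
  set U := U₁ ∩ U₂ with hUdef
  have hU : IsOpen U := hU₁.inter hU₂
  have hp : p ∈ U := ⟨hp₁, hp₂⟩
  replace hX := hX.mono (inter_subset_left : U ⊆ U₁)
  replace hY := hY.mono (inter_subset_left : U ⊆ U₁)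
  replace hV := hV.mono (inter_subset_left : U ⊆ U₁)
  obtain ⟨hT, hW, hfr⟩ := hTW.mono (inter_subset_right : U ⊆ U₂)
  have : CompleteSpace F := FiniteDimensional.complete ℝ F
  set a : M → ℝ := fun q ↦ H.metric q (V q) (T q) with ha
  set b : M → ℝ := fun q ↦ H.metric q (V q) (W q) with hb
  have hca : ContMDiffOn 𝓘(ℝ, F) 𝓘(ℝ, ℝ) ∞ a U := H.contMDiffOn_metric hU hV hT
  have hcb : ContMDiffOn 𝓘(ℝ, F) 𝓘(ℝ, ℝ) ∞ b U := H.contMDiffOn_metric hU hV hW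
  have hda {a : M → ℝ} (ha : ContMDiffOn 𝓘(ℝ, F) 𝓘(ℝ, ℝ) ∞ a U) {q : M} (hq : q ∈ U) :
      MDifferentiableAt 𝓘(ℝ, F) 𝓘(ℝ, ℝ) a q :=
    (ha.contMDiffAt (hU.mem_nhds hq)).mdifferentiableAt (by simp)
  -- In a parallel frame the connection differentiates components only. The frame is parallel just
  -- in screen directions, hence the condition on `X`.
  have comb {a b : M → ℝ} {q : M} (hq : q ∈ U) (ha : MDifferentiableAt 𝓘(ℝ, F) 𝓘(ℝ, ℝ) a q)
      (hb : MDifferentiableAt 𝓘(ℝ, F) 𝓘(ℝ, ℝ) b q) {X : TangentSpace 𝓘(ℝ, F) q}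
      (hX : X ∈ H.screen q) :
      H.screenConn (fun q ↦ a q • T q + b q • W q) q X =
        mvfderiv 𝓘(ℝ, F) a q X • T q + mvfderiv 𝓘(ℝ, F) b q X • W q := by
    have hTd := hT.mdiffAlongAt_push (H := H) hU hq
    have hWd := hW.mdiffAlongAt_push (H := H) hU hq
    have hsm {a : M → ℝ} {T : ∀ p : M, TangentSpace 𝓘(ℝ, F) p}
        (ha : MDifferentiableAt 𝓘(ℝ, F) 𝓘(ℝ, ℝ) a q)
        (hT : MDiffAlongAt (F := F) H.imm (fun q ↦ H.push q (T q)) q) :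
        MDiffAlongAt (F := F) H.imm (fun q ↦ H.push q (a q • T q)) q := by
      simp only [map_smul]
      exact hT.smul ha
    rw [screenConn_add (hsm ha hTd) (hsm hb hWd), screenConn_smul ha hTd (hT.2 q hq),
      screenConn_smul hb hWd (hW.2 q hq), (hpar q hq.2 X hX).1, (hpar q hq.2 X hX).2, smul_zero,
      smul_zero, add_zero, add_zero]
  have hVexp : ∀ q ∈ U, V q = a q • T q + b q • W q := fun q hq ↦
    eq_of_orthonormal hF (hT.2 q hq) (hW.2 q hq) (hfr q hq).1 (hfr q hq).2.1 (hfr q hq).2.2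
      (hV.2 q hq)
  have first {q : M} (hq : q ∈ U) {X : TangentSpace 𝓘(ℝ, F) q} (hX : X ∈ H.screen q) :
      H.screenConn V q X = mvfderiv 𝓘(ℝ, F) a q X • T q + mvfderiv 𝓘(ℝ, F) b q X • W q := by
    rw [← comb hq (hda hca hq) (hda hcb hq) hX]
    refine LinearMap.congr_fun (screenConn_congr ?_) X
    filter_upwards [hU.mem_nhds hq] with q' hq' using hVexp q' hq'
  have second {X Y : ∀ p : M, TangentSpace 𝓘(ℝ, F) p} (hX : IsSmoothSectionOn H.screen U X)
      (hY : IsSmoothSectionOn H.screen U Y) :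
      H.screenConn (fun q ↦ H.screenConn V q (Y q)) p (X p) =
        mvfderiv 𝓘(ℝ, F) (fun q ↦ mvfderiv 𝓘(ℝ, F) a q (Y q)) p (X p) • T p +
          mvfderiv 𝓘(ℝ, F) (fun q ↦ mvfderiv 𝓘(ℝ, F) b q (Y q)) p (X p) • W p := by
    have hYp := hY.mdifferentiableAt hU hp
    rw [← comb hp ((hca.contMDiffAt (hU.mem_nhds hp)).mdifferentiableAt_mvfderiv_apply hYp)
      ((hcb.contMDiffAt (hU.mem_nhds hp)).mdifferentiableAt_mvfderiv_apply hYp) (hX.2 p hp)]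
    refine LinearMap.congr_fun (screenConn_congr ?_) (X p)
    filter_upwards [hU.mem_nhds hp] with q hq using first hq (hY.2 q hq)
  have hXp := hX.mdifferentiableAt hU hp
  have hYp := hY.mdifferentiableAt hU hp
  -- Integrability puts `[X, Y]` in the screen, so `first` applies to it; the bracket identity for
  -- `a` and `b` then cancels everything.
  rw [screenCurv, second hX hY, second hY hX, first hp (hint U hU X Y hX hY p hp),
    ← mvfderiv_mlieBracket (hca.contMDiffAt (hU.mem_nhds hp)) hXp hYp,
    ← mvfderiv_mlieBracket (hcb.contMDiffAt (hU.mem_nhds hp)) hXp hYp, sub_smul, sub_smul]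
  abel

end NullHypersurface
end ParallelField

end

theorem mainTheorem4
    {N : Type*} [TopologicalSpace N] [ChartedSpace (EuclideanSpace ℝ (Fin 4)) N]
    [IsManifold 𝓘(ℝ, EuclideanSpace ℝ (Fin 4)) ∞ N]
    {M : Type*} [TopologicalSpace M] [ChartedSpace (EuclideanSpace ℝ (Fin 3)) M]
    [IsManifold 𝓘(ℝ, EuclideanSpace ℝ (Fin 3)) ∞ M]
    (g : LorentzMetric (EuclideanSpace ℝ (Fin 4)) N)
    (H : NullHypersurface (EuclideanSpace ℝ (Fin 3)) M g)
    (hint : IsIntegrableDistribution H.screen)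
    (Z : ∀ p : M, TangentSpace 𝓘(ℝ, EuclideanSpace ℝ (Fin 4)) (H.imm p))
    (hZ : H.IsSmoothAlong Z)
    (hpar : H.IsParallelAlong Z)
    (hangle : H.HasConstantAngle Z)
    (hstar : ∀ p : M, H.star Z p ≠ 0)
    (htr : ∀ p : M, LinearMap.trace ℝ (H.screen p) (H.shapeOp (H.perp Z) p) = 0) :
    H.IsScreenFlat ∧
      (∀ p : M, ∃ (U : Set M) (W : ∀ q : M, TangentSpace 𝓘(ℝ, EuclideanSpace ℝ (Fin 3)) q),
        IsOpen U ∧ p ∈ U ∧ H.IsOrthonormalScreenFrameOn U (H.unitStar Z) W) ∧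
      ∀ (U : Set M) (W : ∀ q : M, TangentSpace 𝓘(ℝ, EuclideanSpace ℝ (Fin 3)) q),
        IsOpen U → H.IsOrthonormalScreenFrameOn U (H.unitStar Z) W →
          ∀ p ∈ U, ∀ X ∈ H.screen p,
            H.screenConn (H.unitStar Z) p X = 0 ∧ H.screenConn W p X = 0 := by
  have hF : Module.finrank ℝ (EuclideanSpace ℝ (Fin 3)) = 3 := by simp
  have hT := NullHypersurface.isSmoothSectionOn_unitStar hF hZ hstar
  have hext := NullHypersurface.exists_orthonormalScreenFrame_extending hF hT
    (NullHypersurface.metric_unitStar hstar)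
  refine ⟨NullHypersurface.isScreenFlat_of_parallel_frame hF hint fun p ↦ ?_, hext,
    fun U W hU hTW p hp X hX ↦ NullHypersurface.screenConn_frame_eq_zero hF hint hZ hpar hangle
      hstar htr hU hTW hp hX⟩
  obtain ⟨U, W, hU, hp, hTW⟩ := hext p
  exact ⟨U, H.unitStar Z, W, hU, hp, hTW, fun q hq X hX ↦
    NullHypersurface.screenConn_frame_eq_zero hF hint hZ hpar hangle hstar htr hU hTW hq hX⟩
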